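/- Fix $d\in\mathbb N$ and $s>1$. For $h>0$ and $f\in C^\infty(\mathbb R^d)$ (complex-valued) put $$\|f\|_{s,h}=\sup_{\alpha,\beta\in\mathbb N_0^d}\ \sup_{x\in\mathbb R^d}\frac{|x^\alpha\partial^\beta f(x)|}{h^{|\alpha+\beta|}(\alpha!\,\beta!)^s}.$$ The Roumieu Gelfand–Shilov space $\mathcal S_s(\mathbb R^d)$ consists of all $f\in C^\infty(\mathbb R^d)$ with $\|f\|_{s,h}<\infty$ for some $h>0$, with the (locally convex) inductive limit topology; the Beurling space $\Sigma_s(\mathbb R^d)$ consists of all $f\in C^\infty(\mathbb R^d)$ with $\|f\|_{s,h}<\infty$ for every $h>0$, with the projective limit topology. A one-dimensional Wilson basis of exponential decay is an orthonormal basis $\{\psi_{l,n}\}_{l\in\mathbb N_0,\,n\in\mathbb Z}$ of $L^2(\mathbb R)$ of the form $$\psi_{0,n}(x)=\psi(x-n),\qquad \psi_{l,n}(x)=\begin{cases}\sqrt2\,\cos(2\pi l x)\,\psi(x-\tfrac n2), & l\ne0,\ l+n \text{ even},\\ \sqrt2\,\sin(2\pi l x)\,\psi(x-\tfrac n2), &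 l\neq 0,\ l+n\text{ odd},\end{cases}$$ where $\psi:\mathbb R\to\mathbb R$ is continuous and $|\psi(x)|\le Ce^{-a|x|}$, $|\hat\psi(\xi)|\le Ce^{-b|\xi|}$ for all $x,\xi\in\mathbb R$ and some $a,b,C>0$, with $\hat\psi(\xi)=\int\psi(x)e^{-2\pi i x\xi}\,dx$. A Wilson basis of exponential decay on $\mathbb R^d$ is the family of tensor products $\psi_{l,n}(x)=\prod_{k=1}^d\psi^{(k)}_{l_k,n_k}(x_k)$, $l\in\mathbb N_0^d$, $n\in\mathbb Z^d$, of $d$ one-dimensional Wilson bases of exponential decay (which may differ from each other). Write $\langle f,g\rangle=\int_{\mathbb R^d} f\,\overline g\,dx$ and let $|\cdot|$ be the Euclidean norm. **Theorem.** Let $s>1$ and let $\{\psi_{l,n}\}_{l\in\mathbb N_0^d,\,n\in\mathbb Z^d}$ be a Wilson basis of exponential decay on $\mathbb R^d$. Then all $\psi_{l,n}$ belong to $\mathcal S_s(\mathbb R^d)$ (to $\Sigma_s(\mathbb R^d)$), and the following hold. a) If $f\in\mathcal S_s(\mathbb R^d)$ (resp. $f\in\Sigma_s(\mathbb R^d)$),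 then $$f=\sum_{l\in\mathbb N_0^d,\ n\in\mathbb Z^d}c_{l,n}\psi_{l,n},\qquad c_{l,n}=\langle f,\psi_{l,n}\rangle,\tag{1}$$ with unconditional convergence in $\mathcal S_s(\mathbb R^d)$ (resp. in $\Sigma_s(\mathbb R^d)$), and $$\sum_{l\in\mathbb N_0^d,\ n\in\mathbb Z^d}|c_{l,n}|^2e^{2k(|n/2|+|l|)^{1/s}}<\infty\tag{2}$$ for some $k>0$ (resp. for all $k\ge0$). b) Conversely, if $(c_{l,n})_{l\in\mathbb N_0^d,\,n\in\mathbb Z^d}$ is a family of complex numbers such that (2) holds for some $k>0$ (resp. for all $k\ge0$), then there is $f\in\mathcal S_s(\mathbb R^d)$ (resp. $f\in\Sigma_s(\mathbb R^d)$) with $c_{l,n}=\langle f,\psi_{l,n}\rangle$ for all $l,n$, and (1) holds with unconditional convergence in $\mathcal S_s(\mathbb R^d)$ (resp. in $\Sigma_s(\mathbb R^d)$). -/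

import Mathlib

open MeasureTheory Topology
open scoped ContDiff ENNReal FourierTransform

noncomputable section

namespace GelfandShilov

/-- `ℝ^d` with its Euclidean norm. -/
abbrev E (d : ℕ) : Type := EuclideanSpace ℝ (Fin d)

/-! ### Multi-index derivatives and the Gelfand-Shilov norms -/

/-- The partial derivative `∂_i f`. -/
def pderiv {d : ℕ} (i : Fin d) (f : E d → ℂ) : E d → ℂ :=
  fun x => fderiv ℝ f x (EuclideanSpace.single i (1 : ℝ))

/-- The multi-index derivative `∂^β f`, the `i`-th partial derivative being taken `β i` times. -/
def mderiv {d : ℕ} (β : Fin d → ℕ) (f : E d → ℂ) : E d → ℂ :=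
  (List.finRange d).foldr (fun i g => (pderiv i)^[β i] g) f

/-- The monomial `x^α`. -/
def monomial {d : ℕ} (α : Fin d → ℕ) (x : E d) : ℝ := ∏ i, x i ^ α i

/-- The denominator `h^{|α+β|} (α! β!)^s`. -/
def gsDenom {d : ℕ} (s h : ℝ) (α β : Fin d → ℕ) : ℝ :=
  h ^ (∑ i, (α i + β i)) *
    (((∏ i, (α i).factorial) * (∏ i, (β i).factorial) : ℕ) : ℝ) ^ s

/-- The (possibly infinite) norm
`sup_{α, β, x} |x^α ∂^β f(x)| / (h^{|α+β|} (α! β!)^s)`. -/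
def gsENorm {d : ℕ} (s h : ℝ) (f : E d → ℂ) : ℝ≥0∞ :=
  ⨆ (α : Fin d → ℕ) (β : Fin d → ℕ) (x : E d),
    ENNReal.ofReal (‖(monomial α x : ℂ) * mderiv β f x‖ / gsDenom s h α β)

/-! ### Facts that make the spaces below vector spaces -/

theorem contDiff_pderiv {d : ℕ} (i : Fin d) {f : E d → ℂ} (hf : ContDiff ℝ ∞ f) :
    ContDiff ℝ ∞ (pderiv i f) := by
  have h1 : ContDiff ℝ ∞ (fderiv ℝ f) := hf.fderiv_right (by simp)
  exact h1.clm_apply contDiff_const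

theorem contDiff_pderiv_iterate {d : ℕ} (i : Fin d) (k : ℕ) {f : E d → ℂ}
    (hf : ContDiff ℝ ∞ f) : ContDiff ℝ ∞ ((pderiv i)^[k] f) := by
  induction k with
  | zero => simpa using hf
  | succ k ih =>
    rw [Function.iterate_succ_apply']
    exact contDiff_pderiv i ih

theorem pderiv_add {d : ℕ} (i : Fin d) {f g : E d → ℂ} (hf : ContDiff ℝ ∞ f)
    (hg : ContDiff ℝ ∞ g) : pderiv i (f + g) = pderiv i f + pderiv i g := by
  funext x
  simp only [pderiv, Pi.add_apply]
  rw [fderiv_add (hf.differentiable (by simp) x) (hg.differentiable (by simp) x)]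
  rfl

theorem pderiv_smul {d : ℕ} (i : Fin d) (c : ℂ) {f : E d → ℂ} (hf : ContDiff ℝ ∞ f) :
    pderiv i (c • f) = c • pderiv i f := by
  funext x
  simp only [pderiv, Pi.smul_apply]
  rw [fderiv_const_smul (hf.differentiable (by simp) x)]
  rfl

theorem pderiv_iterate_add {d : ℕ} (i : Fin d) (k : ℕ) {f g : E d → ℂ} (hf : ContDiff ℝ ∞ f)
    (hg : ContDiff ℝ ∞ g) :
    (pderiv i)^[k] (f + g) = (pderiv i)^[k] f + (pderiv i)^[k] g := by
  induction k with
  | zero => rfl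
  | succ k ih =>
    simp only [Function.iterate_succ_apply']
    rw [ih, pderiv_add i (contDiff_pderiv_iterate i k hf) (contDiff_pderiv_iterate i k hg)]

theorem pderiv_iterate_smul {d : ℕ} (i : Fin d) (k : ℕ) (c : ℂ) {f : E d → ℂ}
    (hf : ContDiff ℝ ∞ f) : (pderiv i)^[k] (c • f) = c • (pderiv i)^[k] f := by
  induction k with
  | zero => rfl
  | succ k ih =>
    simp only [Function.iterate_succ_apply']
    rw [ih, pderiv_smul i c (contDiff_pderiv_iterate i k hf)]

theorem contDiff_foldr {d : ℕ} (β : Fin d → ℕ) (L : List (Fin d)) {f : E d → ℂ}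
    (hf : ContDiff ℝ ∞ f) :
    ContDiff ℝ ∞ (L.foldr (fun i g => (pderiv i)^[β i] g) f) := by
  induction L with
  | nil => simpa using hf
  | cons i L ih => exact contDiff_pderiv_iterate i (β i) ih

theorem mderiv_add {d : ℕ} (β : Fin d → ℕ) {f g : E d → ℂ} (hf : ContDiff ℝ ∞ f)
    (hg : ContDiff ℝ ∞ g) : mderiv β (f + g) = mderiv β f + mderiv β g := by
  unfold mderiv
  induction List.finRange d with
  | nil => rfl
  | cons i L ih =>
    simp only [List.foldr_cons]
    rw [ih, pderiv_iterate_add i _ (contDiff_foldr β L hf) (contDiff_foldr β L hg)]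

theorem mderiv_smul {d : ℕ} (β : Fin d → ℕ) (c : ℂ) {f : E d → ℂ} (hf : ContDiff ℝ ∞ f) :
    mderiv β (c • f) = c • mderiv β f := by
  unfold mderiv
  induction List.finRange d with
  | nil => rfl
  | cons i L ih =>
    simp only [List.foldr_cons]
    rw [ih, pderiv_iterate_smul i _ c (contDiff_foldr β L hf)]

theorem gsDenom_pos {d : ℕ} (s : ℝ) {h : ℝ} (hh : 0 < h) (α β : Fin d → ℕ) :
    0 < gsDenom s h α β := by
  unfold gsDenom
  have : 0 < (∏ i, (α i).factorial) * (∏ i, (β i).factorial) :=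
    Nat.mul_pos (Finset.prod_pos fun i _ => Nat.factorial_pos _)
      (Finset.prod_pos fun i _ => Nat.factorial_pos _)
  have h2 : (0 : ℝ) < (((∏ i, (α i).factorial) * (∏ i, (β i).factorial) : ℕ) : ℝ) := by
    exact_mod_cast this
  exact mul_pos (pow_pos hh _) (Real.rpow_pos_of_pos h2 s)

theorem gsENorm_zero {d : ℕ} (s h : ℝ) : gsENorm s h (0 : E d → ℂ) = 0 := by
  have key : ∀ β : Fin d → ℕ, mderiv β (0 : E d → ℂ) = 0 := fun β => by
    have := mderiv_smul β 0 (f := (0 : E d → ℂ)) contDiff_const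
    simpa using this
  simp [gsENorm, key]

theorem gsENorm_add_le {d : ℕ} (s : ℝ) {h : ℝ} (hh : 0 < h) {f g : E d → ℂ}
    (hf : ContDiff ℝ ∞ f) (hg : ContDiff ℝ ∞ g) :
    gsENorm s h (f + g) ≤ gsENorm s h f + gsENorm s h g := by
  refine iSup_le fun α => iSup_le fun β => iSup_le fun x => ?_
  have hD := gsDenom_pos s hh α β
  refine le_trans ?_ (add_le_add
    (le_iSup_of_le α (le_iSup_of_le β (le_iSup_of_le x le_rfl)))
    (le_iSup_of_le α (le_iSup_of_le β (le_iSup_of_le x le_rfl))))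
  rw [← ENNReal.ofReal_add (by positivity) (by positivity), ← add_div]
  refine ENNReal.ofReal_le_ofReal ?_
  gcongr
  rw [mderiv_add β hf hg, Pi.add_apply, mul_add]
  exact norm_add_le _ _

theorem gsENorm_smul {d : ℕ} (s h : ℝ) (c : ℂ) {f : E d → ℂ}
    (hf : ContDiff ℝ ∞ f) : gsENorm s h (c • f) = ENNReal.ofReal ‖c‖ * gsENorm s h f := by
  unfold gsENorm
  simp only [ENNReal.mul_iSup]
  refine iSup_congr fun α => iSup_congr fun β => iSup_congr fun x => ?_
  rw [← ENNReal.ofReal_mul (norm_nonneg c), mderiv_smul β c hf, Pi.smul_apply, smul_eq_mul]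
  congr 1
  simp only [norm_mul]
  ring

theorem gsENorm_anti {d : ℕ} (s : ℝ) {h h' : ℝ} (hh : 0 < h) (hle : h ≤ h') (f : E d → ℂ) :
    gsENorm s h' f ≤ gsENorm s h f := by
  refine iSup_mono fun α => iSup_mono fun β => iSup_mono fun x => ?_
  refine ENNReal.ofReal_le_ofReal ?_
  have hD := gsDenom_pos s hh α β
  have hle' : gsDenom s h α β ≤ gsDenom s h' α β := by
    unfold gsDenom
    gcongr
  gcongr

/-! ### The Banach steps -/

/-- Smooth functions whose norm with parameter `h` is finite, as a space of functions. -/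
def stepSubmodule (d : ℕ) (s : ℝ) (h : Set.Ioi (0 : ℝ)) : Submodule ℂ (E d → ℂ) where
  carrier := {f | ContDiff ℝ ∞ f ∧ gsENorm s h f < ⊤}
  zero_mem' := ⟨contDiff_const, by rw [gsENorm_zero]; simp⟩
  add_mem' := fun {f g} hf hg => ⟨hf.1.add hg.1,
    lt_of_le_of_lt (gsENorm_add_le s h.2 hf.1 hg.1) (ENNReal.add_lt_top.2 ⟨hf.2, hg.2⟩)⟩
  smul_mem' := fun c f hf => ⟨hf.1.const_smul c, by
    rw [gsENorm_smul s h c hf.1]; exact ENNReal.mul_lt_top ENNReal.ofReal_lt_top hf.2⟩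

/-- The space of all smooth `f` whose norm with parameter `h` is finite, normed by it. -/
def Step (d : ℕ) (s : ℝ) (h : Set.Ioi (0 : ℝ)) : Type := ↥(stepSubmodule d s h)

instance (d : ℕ) (s : ℝ) (h : Set.Ioi (0 : ℝ)) : AddCommGroup (Step d s h) :=
  inferInstanceAs (AddCommGroup ↥(stepSubmodule d s h))

instance (d : ℕ) (s : ℝ) (h : Set.Ioi (0 : ℝ)) : Module ℂ (Step d s h) :=
  inferInstanceAs (Module ℂ ↥(stepSubmodule d s h))

/-- The norm of the step. -/
def stepSeminorm (d : ℕ) (s : ℝ) (h : Set.Ioi (0 : ℝ)) : Seminorm ℂ (Step d s h) :=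
  Seminorm.of (fun f => (gsENorm s h f.1).toReal)
    (fun f g => by
      refine le_trans (ENNReal.toReal_mono (ENNReal.add_ne_top.2 ⟨f.2.2.ne, g.2.2.ne⟩)
        (gsENorm_add_le s h.2 f.2.1 g.2.1)) ?_
      rw [ENNReal.toReal_add f.2.2.ne g.2.2.ne])
    (fun c f => by
      refine (congrArg ENNReal.toReal (gsENorm_smul s h c f.2.1)).trans ?_
      rw [ENNReal.toReal_mul, ENNReal.toReal_ofReal (norm_nonneg c)])

instance (d : ℕ) (s : ℝ) (h : Set.Ioi (0 : ℝ)) : SeminormedAddCommGroup (Step d s h) :=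
  AddGroupSeminorm.toSeminormedAddCommGroup (stepSeminorm d s h).toAddGroupSeminorm

/-! ### The Roumieu space and its inductive limit topology -/

/-- Smooth functions whose norm is finite for some `h > 0`. -/
def roumieuSubmodule (d : ℕ) (s : ℝ) : Submodule ℂ (E d → ℂ) where
  carrier := {f | ContDiff ℝ ∞ f ∧ ∃ h : ℝ, 0 < h ∧ gsENorm s h f < ⊤}
  zero_mem' := ⟨contDiff_const, 1, one_pos, by rw [gsENorm_zero]; simp⟩
  add_mem' := by
    rintro f g ⟨hf, h, hh, hfh⟩ ⟨hg, k, hk, hgk⟩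
    refine ⟨hf.add hg, max h k, lt_max_of_lt_left hh, ?_⟩
    refine lt_of_le_of_lt (gsENorm_add_le s (lt_max_of_lt_left hh) hf hg) ?_
    exact ENNReal.add_lt_top.2
      ⟨lt_of_le_of_lt (gsENorm_anti s hh (le_max_left h k) f) hfh,
       lt_of_le_of_lt (gsENorm_anti s hk (le_max_right h k) g) hgk⟩
  smul_mem' := by
    rintro c f ⟨hf, h, hh, hfh⟩
    refine ⟨hf.const_smul c, h, hh, ?_⟩
    rw [gsENorm_smul s h c hf]
    exact ENNReal.mul_lt_top ENNReal.ofReal_lt_top hfh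

/-- The Roumieu space `𝒮_s(ℝ^d)`. -/
def Roumieu (d : ℕ) (s : ℝ) : Type := ↥(roumieuSubmodule d s)

instance (d : ℕ) (s : ℝ) : AddCommGroup (Roumieu d s) :=
  inferInstanceAs (AddCommGroup ↥(roumieuSubmodule d s))

instance (d : ℕ) (s : ℝ) : Module ℂ (Roumieu d s) :=
  inferInstanceAs (Module ℂ ↥(roumieuSubmodule d s))

/-- A function, regarded as an element of the Roumieu space. -/
def Roumieu.mk {d : ℕ} {s : ℝ} (f : E d → ℂ) (hf : f ∈ roumieuSubmodule d s) : Roumieu d s :=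
  ⟨f, hf⟩

/-- The inclusion of a step into the Roumieu space. -/
def stepToRoumieu {d : ℕ} {s : ℝ} (h : Set.Ioi (0 : ℝ)) (f : Step d s h) : Roumieu d s :=
  ⟨f.1, f.2.1, h.1, h.2, f.2.2⟩

/-- The inductive limit topology, in the category of locally convex spaces: the finest locally
convex vector space topology for which the inclusions of all steps are continuous. -/
instance (d : ℕ) (s : ℝ) : TopologicalSpace (Roumieu d s) :=
  sInf {t : TopologicalSpace (Roumieu d s) |
    (∀ h : Set.Ioi (0 : ℝ), @Continuous (Step d s h) (Roumieu d s) _ t (stepToRoumieu h)) ∧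
    @IsTopologicalAddGroup (Roumieu d s) t _ ∧
    @ContinuousSMul ℂ (Roumieu d s) _ _ t ∧
    @LocallyConvexSpace ℝ (Roumieu d s) _ _ _ _ t}

/-! ### The Beurling space and its projective limit topology -/

/-- Smooth functions whose norm is finite for every `h > 0`. -/
def beurlingSubmodule (d : ℕ) (s : ℝ) : Submodule ℂ (E d → ℂ) where
  carrier := {f | ContDiff ℝ ∞ f ∧ ∀ h : ℝ, 0 < h → gsENorm s h f < ⊤}
  zero_mem' := ⟨contDiff_const, fun h _ => by rw [gsENorm_zero]; simp⟩
  add_mem' := by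
    rintro f g ⟨hf, hf'⟩ ⟨hg, hg'⟩
    exact ⟨hf.add hg, fun h hh => lt_of_le_of_lt (gsENorm_add_le s hh hf hg)
      (ENNReal.add_lt_top.2 ⟨hf' h hh, hg' h hh⟩)⟩
  smul_mem' := by
    rintro c f ⟨hf, hf'⟩
    refine ⟨hf.const_smul c, fun h hh => ?_⟩
    rw [gsENorm_smul s h c hf]
    exact ENNReal.mul_lt_top ENNReal.ofReal_lt_top (hf' h hh)

/-- The Beurling space `Σ_s(ℝ^d)`. -/
def Beurling (d : ℕ) (s : ℝ) : Type := ↥(beurlingSubmodule d s)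

instance (d : ℕ) (s : ℝ) : AddCommGroup (Beurling d s) :=
  inferInstanceAs (AddCommGroup ↥(beurlingSubmodule d s))

instance (d : ℕ) (s : ℝ) : Module ℂ (Beurling d s) :=
  inferInstanceAs (Module ℂ ↥(beurlingSubmodule d s))

/-- A function, regarded as an element of the Beurling space. -/
def Beurling.mk {d : ℕ} {s : ℝ} (f : E d → ℂ) (hf : f ∈ beurlingSubmodule d s) : Beurling d s :=
  ⟨f, hf⟩

/-- The inclusion of the Beurling space into a step. -/
def beurlingToStep {d : ℕ} {s : ℝ} (h : Set.Ioi (0 : ℝ)) (f : Beurling d s) : Step d s h :=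
  ⟨f.1, f.2.1, f.2.2 h.1 h.2⟩

/-- The projective limit topology: the coarsest topology for which the inclusions into all steps
are continuous. -/
instance (d : ℕ) (s : ℝ) : TopologicalSpace (Beurling d s) :=
  ⨅ h : Set.Ioi (0 : ℝ), TopologicalSpace.induced (beurlingToStep h) inferInstance

/-! ### Wilson bases -/

/-- The one-dimensional Wilson system of `ψ`: `ψ_{0,n} = T_n ψ` and, for `l ≠ 0`,
`ψ_{l,n} = √2 Re (M_l T_{n/2} ψ)` if `l + n` is even,
`ψ_{l,n} = √2 Im (M_l T_{n/2} ψ)` if `l + n` is odd; since `ψ` is real-valued, real and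
imaginary part amount to a cosine and a sine. -/
def wilson1 (ψ : ℝ → ℝ) (l : ℕ) (n : ℤ) (x : ℝ) : ℝ :=
  if l = 0 then ψ (x - n)
  else if Even ((l : ℤ) + n) then √2 * Real.cos (2 * Real.pi * l * x) * ψ (x - n / 2)
  else √2 * Real.sin (2 * Real.pi * l * x) * ψ (x - n / 2)

/-- `ψ` generates a Wilson basis of exponential decay of `L²(ℝ)`. Continuity only selects the
representative: a function with exponentially decaying Fourier transform is almost everywhere equal
to a continuous one. -/
structure IsWilsonGenerator (ψ : ℝ → ℝ) : Prop where
  continuous : Continuous ψ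
  decay : ∃ C a b : ℝ, 0 < C ∧ 0 < a ∧ 0 < b ∧
    (∀ x : ℝ, |ψ x| ≤ C * Real.exp (-a * |x|)) ∧
    (∀ ξ : ℝ, ‖𝓕 (fun x : ℝ => (ψ x : ℂ)) ξ‖ ≤ C * Real.exp (-b * |ξ|))
  orthonormal_basis : ∃ B : HilbertBasis (ℕ × ℤ) ℂ (Lp ℂ 2 (volume : Measure ℝ)),
    ∀ (l : ℕ) (n : ℤ), (B (l, n) : ℝ → ℂ) =ᵐ[volume] fun x => (wilson1 ψ l n x : ℂ)

/-- The index set of pairs `(l, n)` with `l ∈ ℕ₀^d` and `n ∈ ℤ^d`. -/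
abbrev Idx (d : ℕ) : Type := (Fin d → ℕ) × (Fin d → ℤ)

/-- The `d`-dimensional (tensor product) Wilson system; the generators of the `d` factors may
differ. -/
def wilson {d : ℕ} (ψ : Fin d → ℝ → ℝ) (p : Idx d) (x : E d) : ℂ :=
  ∏ k, (wilson1 (ψ k) (p.1 k) (p.2 k) (x k) : ℂ)

/-- `⟨f, g⟩ = ∫ f(x) conj(g(x)) dx`. -/
def pairing {d : ℕ} (f g : E d → ℂ) : ℂ := ∫ x, f x * (starRingEnd ℂ) (g x)

/-- `|n/2| + |l|`, with Euclidean norms. -/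
def idxSize {d : ℕ} (p : Idx d) : ℝ :=
  ‖(WithLp.toLp 2 (fun i => (p.2 i : ℝ) / 2) : E d)‖ +
    ‖(WithLp.toLp 2 (fun i => (p.1 i : ℝ)) : E d)‖

/-- `∑ |c_{l,n}|² e^{2k(|n/2| + |l|)^{1/s}} < ∞`. -/
def WeightedSummable {d : ℕ} (s k : ℝ) (c : Idx d → ℂ) : Prop :=
  Summable fun p => ‖c p‖ ^ 2 * Real.exp (2 * k * idxSize p ^ (1 / s))

end GelfandShilov

end

noncomputable section

namespace GelfandShilov

/-! Everything reduces to two quantitative statements about a single norm `gsENorm s h`: the norm of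
`wilson ψ p` grows at most like a stretched exponential of `idxSize p ^ (1 / s)`, and the
coefficients of a function with finite norm decay like such an exponential. In both, the rate is an
explicit constant times `h ^ (-1 / s)`.

The windows are analytic. Exponential decay of the Fourier transform extends the window to a bounded
holomorphic function on a strip; Phragmén–Lindelöf carries the decay on the real axis into the
strip, and Cauchy's estimates give derivatives of size `H ^ m * m!` with exponential decay
(`IsWilsonGenerator.exists_derivatives`). Since `s > 1`, this lies below every Gevrey weight `ε ^ m
* (m!) ^ s`, so the windows never limit the rate. Frequency and centre enter only through powers,
which cost a stretched exponential by `pow_le_exp_mul_gevrey`; this gives `exists_wilsonJet_bound`.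

For the coefficients, powers of the centre are absorbed by the decay of `f` and of the window, and
powers of the frequency by integration by parts. Optimising over the power turns these bounds into
decay (`exists_norm_pairing_le`).

If the coefficients decay faster than the Wilson norms grow, the Wilson series converges absolutely
in the norm, and orthonormality recovers its coefficients (`wilsonSeries_spec`). A function with
finite norm that is orthogonal to all Wilson functions vanishes: completeness is used one coordinate
at a time (`eq_zero_of_pairing_eq_zero`). Hence `f` equals its Wilson series. In the Roumieu case
`h` is taken large enough for the growth to lose against the given decay; in the Beurling case the
decay beats every rate, so every `h` works. -/

/-! ### Gevrey weights against stretched exponentials. -/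

theorem pow_le_exp_mul_factorial {x : ℝ} (hx : 0 ≤ x) (m : ℕ) :
    x ^ m ≤ Real.exp x * m.factorial := by
  have h := Real.pow_div_factorial_le_exp x hx m
  rwa [div_le_iff₀ (by positivity)] at h

theorem factorial_rpow_pos (s : ℝ) (m : ℕ) : 0 < (m.factorial : ℝ) ^ s :=
  Real.rpow_pos_of_pos (by positivity) s

theorem factorial_rpow_mul_le {s : ℝ} (hs : 0 ≤ s) (m n : ℕ) :
    (m.factorial : ℝ) ^ s * (n.factorial : ℝ) ^ s ≤ ((m + n).factorial : ℝ) ^ s := by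
  rw [← Real.mul_rpow (by positivity) (by positivity)]
  refine Real.rpow_le_rpow (by positivity) ?_ hs
  exact_mod_cast Nat.le_of_dvd (Nat.factorial_pos _) (Nat.factorial_mul_factorial_dvd_factorial_add m n)

/-- Powers are dominated by Gevrey weights, up to a stretched exponential. -/
theorem pow_le_exp_mul_gevrey {s h t : ℝ} (hs : 0 < s) (hh : 0 < h) (ht : 0 ≤ t) (m : ℕ) :
    t ^ m ≤ Real.exp (s * (t / h) ^ (1 / s)) * (h ^ m * (m.factorial : ℝ) ^ s) := by
  set u := (t / h) ^ (1 / s) with hu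
  have hu0 : 0 ≤ u := by positivity
  have hth : t / h = u ^ s := by
    rw [hu, ← Real.rpow_mul (by positivity), one_div_mul_cancel hs.ne', Real.rpow_one]
  -- With `t / h = u ^ s`, the claim is the `s`-th power of `u ^ m ≤ exp u * m!`.
  have h1 : (u ^ m) ^ s ≤ (Real.exp u * m.factorial) ^ s :=
    Real.rpow_le_rpow (by positivity) (pow_le_exp_mul_factorial hu0 m) hs.le
  rw [Real.mul_rpow (by positivity) (by positivity), ← Real.exp_mul, ← Real.rpow_natCast u m,
    ← Real.rpow_mul hu0, mul_comm (m : ℝ) s, Real.rpow_mul hu0, ← hth, Real.rpow_natCast,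
    div_pow, div_le_iff₀ (by positivity)] at h1
  calc t ^ m ≤ _ := h1
    _ = _ := by rw [mul_comm u s]; ring

/-- Analytic weights are dominated by Gevrey weights of arbitrarily small radius. -/
theorem exists_analytic_le_gevrey {s A ε : ℝ} (hs : 1 < s) (hA : 0 < A) (hε : 0 < ε) :
    ∃ C : ℝ, 0 < C ∧ ∀ m : ℕ, A ^ m * m.factorial ≤ C * (ε ^ m * (m.factorial : ℝ) ^ s) := by
  -- The power bound is applied with exponent `s - 1`, the surplus of `(m!) ^ s` over `m!`. This is
  -- where `s > 1` is essential.
  refine ⟨Real.exp ((s - 1) * (A / ε) ^ (1 / (s - 1))), Real.exp_pos _, fun m => ?_⟩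
  have h := pow_le_exp_mul_gevrey (sub_pos.2 hs) hε hA.le m
  have h2 : (m.factorial : ℝ) ^ s = (m.factorial : ℝ) ^ (s - 1) * m.factorial := by
    rw [← Real.rpow_add_one (by positivity)]; congr 1; ring
  rw [h2]
  refine (mul_le_mul_of_nonneg_right h (Nat.cast_nonneg m.factorial)).trans_eq ?_
  ring

/-- A bound by Gevrey weights gives stretched exponential decay. -/
theorem le_exp_of_forall_pow_mul_le {s h t A B : ℝ} (hs : 0 < s) (hh : 0 < h) (ht : 0 ≤ t)
    (hA : 0 ≤ A) (hB : 0 ≤ B) (H : ∀ m : ℕ, t ^ m * B ≤ A * (h ^ m * (m.factorial : ℝ) ^ s)) :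
    B ≤ 2 ^ s * A * Real.exp (-(s / 2 * (t / h) ^ (1 / s))) := by
  set u := (t / h) ^ (1 / s) with hu
  have hu0 : 0 ≤ u := by positivity
  have hth : t / h = u ^ s := by
    rw [hu, ← Real.rpow_mul (by positivity), one_div_mul_cancel hs.ne', Real.rpow_one]
  -- Taking `1 / s`-th powers produces the terms of an exponential series. Halving `u` makes the
  -- right side geometric, so summing over `m` replaces an optimisation in `m`; the sum 2 becomes
  -- the factor `2 ^ s`.
  have key : ∀ m : ℕ, (u / 2) ^ m / m.factorial * B ^ (1 / s) ≤ (1 / 2) ^ m * A ^ (1 / s) := by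
    intro m
    have h1 : (u ^ m) ^ s * B ≤ A * (m.factorial : ℝ) ^ s := by
      rw [← Real.rpow_natCast u m, ← Real.rpow_mul hu0, mul_comm (m : ℝ) s, Real.rpow_mul hu0,
        ← hth, Real.rpow_natCast, div_pow, div_mul_eq_mul_div, div_le_iff₀ (by positivity)]
      linarith [H m]
    have h2 := Real.rpow_le_rpow (by positivity) h1 (by positivity : 0 ≤ 1 / s)
    rw [Real.mul_rpow (by positivity) hB, Real.mul_rpow hA (by positivity),
      ← Real.rpow_mul (by positivity), ← Real.rpow_mul (by positivity), mul_one_div_cancel hs.ne',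
      Real.rpow_one, Real.rpow_one] at h2
    rw [div_pow, one_div_pow, div_div, div_mul_eq_mul_div, div_le_iff₀ (by positivity)]
    calc u ^ m * B ^ (1 / s) ≤ _ := h2
      _ = _ := by field_simp
  have hexp : HasSum (fun m : ℕ => (u / 2) ^ m / m.factorial * B ^ (1 / s))
      (Real.exp (u / 2) * B ^ (1 / s)) := by
    have := NormedSpace.expSeries_div_hasSum_exp (u / 2)
    rw [← Real.exp_eq_exp_ℝ] at this
    exact this.mul_right _
  have hgeo : HasSum (fun m : ℕ => (1 / 2 : ℝ) ^ m * A ^ (1 / s)) (2 * A ^ (1 / s)) :=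
    hasSum_geometric_two.mul_right _
  have h3 := hasSum_le key hexp hgeo
  have h4 := Real.rpow_le_rpow (by positivity) h3 hs.le
  rw [Real.mul_rpow (by positivity) (by positivity), Real.mul_rpow (by positivity) (by positivity),
    ← Real.rpow_mul hB, ← Real.rpow_mul hA, one_div_mul_cancel hs.ne', Real.rpow_one,
    Real.rpow_one, ← Real.exp_mul] at h4
  rw [Real.exp_neg, ← div_eq_mul_inv, le_div_iff₀ (Real.exp_pos _)]
  calc B * Real.exp (s / 2 * u) = Real.exp (u / 2 * s) * B := by rw [mul_comm]; congr 2; ring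
    _ ≤ _ := h4

/-! ### Analyticity of the windows. -/

theorem integrable_exp_neg_abs {c : ℝ} (hc : 0 < c) :
    Integrable (fun x : ℝ => Real.exp (-c * |x|)) := by
  rw [← integrableOn_univ, ← Set.Iic_union_Ioi (a := (0 : ℝ))]
  refine IntegrableOn.union ?_ ?_
  · refine (integrableOn_exp_mul_Iic hc 0).congr_fun (fun x hx => ?_) measurableSet_Iic
    simp only [abs_of_nonpos (Set.mem_Iic.1 hx)]
    congr 1; ring
  · refine (integrableOn_exp_mul_Ioi (neg_lt_zero.2 hc) 0).congr_fun (fun x hx => ?_)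
      measurableSet_Ioi
    simp only [abs_of_pos (Set.mem_Ioi.1 hx)]

/-- A bounded holomorphic function on a strip that decays exponentially on the real axis decays
exponentially inside the strip. -/
theorem norm_le_exp_of_strip {F : ℂ → ℂ} {a b b₀ M : ℝ} (hb : 0 < b) (hbb : b < b₀)
    (hF : DifferentiableOn ℂ F {z | |z.im| < b₀}) (hM : ∀ z : ℂ, |z.im| < b₀ → ‖F z‖ ≤ M)
    (hR : ∀ x : ℝ, ‖F x‖ ≤ M * Real.exp (-(a * x))) {z : ℂ} (hz0 : 0 ≤ z.im) (hzb : z.im ≤ b) :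
    ‖F z‖ ≤ M * Real.exp (-(a * z.re * (1 - z.im / b))) := by
  have hM0 : 0 ≤ M := (norm_nonneg _).trans (hM 0 (by simpa using hb.trans hbb))
  -- The quadratic term is chosen so that `Re φ` is `a * z.re` on the real axis and 0 on `Im z = b`.
  -- Thus `F * exp φ` is bounded by `M` on both edges of the strip.
  set φ : ℂ → ℂ := fun z => a * z + Complex.I * (a / (2 * b)) * z ^ 2 with hφ
  have hre : ∀ z : ℂ, (φ z).re = a * z.re * (1 - z.im / b) := by
    intro z
    have : (a / (2 * b) : ℂ) = ((a / (2 * b) : ℝ) : ℂ) := by push_cast; rfl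
    simp only [hφ, this, sq, Complex.add_re, Complex.mul_re, Complex.mul_im, Complex.ofReal_re,
      Complex.ofReal_im, Complex.I_re, Complex.I_im]
    field_simp
    ring
  have hopen : ∀ z : ℂ, 0 ≤ z.im → z.im ≤ b → |z.im| < b₀ := fun z h0 h1 => by
    rw [abs_of_nonneg h0]; exact h1.trans_lt hbb
  have hUo : IsOpen {z : ℂ | |z.im| < b₀} :=
    isOpen_lt (continuous_abs.comp Complex.continuous_im) continuous_const
  have hGd : ∀ z : ℂ, 0 ≤ z.im → z.im ≤ b →
      DifferentiableAt ℂ (fun z => F z * Complex.exp (φ z)) z := by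
    intro z h0 h1
    have h2 : DifferentiableAt ℂ φ z := by fun_prop
    exact ((hF z (hopen z h0 h1)).differentiableAt (hUo.mem_nhds (hopen z h0 h1))).mul h2.cexp
  have hG : ‖F z * Complex.exp (φ z)‖ ≤ M := by
    refine PhragmenLindelof.horizontal_strip (a := 0) (b := b) (f := fun z => F z * Complex.exp (φ z))
      ?_ ?_ ?_ ?_ hz0 hzb
    · refine DifferentiableOn.diffContOnCl fun z hz => (hGd z ?_ ?_).differentiableWithinAt
      · have := closure_minimal (s := Complex.im ⁻¹' Set.Ioo 0 b) (t := Complex.im ⁻¹' Set.Icc 0 b)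
          (Set.preimage_mono Set.Ioo_subset_Icc_self)
          (isClosed_Icc.preimage Complex.continuous_im) hz
        exact this.1
      · have := closure_minimal (s := Complex.im ⁻¹' Set.Ioo 0 b) (t := Complex.im ⁻¹' Set.Icc 0 b)
          (Set.preimage_mono Set.Ioo_subset_Icc_self)
          (isClosed_Icc.preimage Complex.continuous_im) hz
        exact this.2
    -- The a priori growth `exp (|a| * |Re z|)` is far below the admissible double exponential; any
    -- rate below `π / b` would do.
    · have hc : 0 < Real.pi / (2 * b) := by positivity
      refine ⟨Real.pi / (2 * b), ?_, |a| / (Real.pi / (2 * b)), ?_⟩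
      · rw [sub_zero]
        exact div_lt_div_of_pos_left Real.pi_pos hb (by linarith)
      · refine Asymptotics.IsBigO.of_bound M ?_
        refine Filter.eventually_inf_principal.2 (Filter.Eventually.of_forall fun z hz => ?_)
        rw [norm_mul, Complex.norm_exp, hre, Real.norm_of_nonneg (Real.exp_pos _).le]
        refine mul_le_mul (hM z (hopen z hz.1.le hz.2.le)) (Real.exp_le_exp.2 ?_)
          (Real.exp_pos _).le hM0
        have h1 : |1 - z.im / b| ≤ 1 := by
          have h2 : 0 < z.im / b := div_pos hz.1 hb
          have h3 : z.im / b < 1 := (div_lt_one hb).2 hz.2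
          rw [abs_le]; constructor <;> linarith
        have h4 : |z.re| ≤ Real.exp (Real.pi / (2 * b) * |z.re|) / (Real.pi / (2 * b)) := by
          rw [le_div_iff₀ hc]
          linarith [Real.add_one_le_exp (Real.pi / (2 * b) * |z.re|)]
        calc a * z.re * (1 - z.im / b) ≤ |a * z.re * (1 - z.im / b)| := le_abs_self _
          _ = |a| * |z.re| * |1 - z.im / b| := by rw [abs_mul, abs_mul]
          _ ≤ |a| * (Real.exp (Real.pi / (2 * b) * |z.re|) / (Real.pi / (2 * b))) * 1 := by
            gcongr
          _ = _ := by ring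
    · intro z hz
      have hzr : z = (z.re : ℂ) := by apply Complex.ext <;> simp [hz]
      rw [norm_mul, Complex.norm_exp, hre, hz, zero_div, sub_zero, mul_one]
      have h1 := hR z.re
      rw [← hzr] at h1
      calc ‖F z‖ * Real.exp (a * z.re) ≤ M * Real.exp (-(a * z.re)) * Real.exp (a * z.re) := by
            gcongr
        _ = M := by rw [mul_assoc, ← Real.exp_add]; simp
    · intro z hz
      rw [norm_mul, Complex.norm_exp, hre, hz, div_self hb.ne']
      simpa using hM z (hopen z (hz ▸ hb.le) hz.le)
  rw [norm_mul, Complex.norm_exp, hre] at hG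
  rw [Real.exp_neg, ← div_eq_mul_inv, le_div_iff₀ (Real.exp_pos _)]
  exact hG

/-- Two-sided version of `norm_le_exp_of_strip`. -/
theorem norm_le_exp_abs_of_strip {F : ℂ → ℂ} {a b b₀ M : ℝ} (ha : 0 ≤ a) (hb : 0 < b) (hbb : b < b₀)
    (hF : DifferentiableOn ℂ F {z | |z.im| < b₀}) (hM : ∀ z : ℂ, |z.im| < b₀ → ‖F z‖ ≤ M)
    (hR : ∀ x : ℝ, ‖F x‖ ≤ M * Real.exp (-(a * |x|))) {z : ℂ} (hz : |z.im| ≤ b / 2) :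
    ‖F z‖ ≤ M * Real.exp (-(a / 2 * |z.re|)) := by
  have hM0 : 0 ≤ M := (norm_nonneg _).trans (hM 0 (by simpa using hb.trans hbb))
  have upper : ∀ {G : ℂ → ℂ}, DifferentiableOn ℂ G {z | |z.im| < b₀} →
      (∀ z : ℂ, |z.im| < b₀ → ‖G z‖ ≤ M) → (∀ x : ℝ, ‖G x‖ ≤ M * Real.exp (-(a * |x|))) →
      ∀ z : ℂ, 0 ≤ z.im → z.im ≤ b / 2 → ‖G z‖ ≤ M * Real.exp (-(a / 2 * |z.re|)) := by
    intro G hG hGM hGR z h0 h1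
    have hhalf : 1 / 2 ≤ 1 - z.im / b := by
      have : z.im / b ≤ 1 / 2 := by rw [div_le_iff₀ hb]; linarith
      linarith
    have hk : a / 2 * |z.re| ≤ a * |z.re| * (1 - z.im / b) := by
      calc a / 2 * |z.re| = a * |z.re| * (1 / 2) := by ring
        _ ≤ _ := by gcongr
    rcases le_total 0 z.re with hx | hx
    · refine (norm_le_exp_of_strip (a := a) hb hbb hG hGM (fun x => (hGR x).trans ?_) h0
        (by linarith)).trans ?_
      · gcongr; exact le_abs_self x
      · rw [abs_of_nonneg hx] at hk ⊢
        gcongr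
    · refine (norm_le_exp_of_strip (a := -a) hb hbb hG hGM (fun x => (hGR x).trans ?_) h0
        (by linarith)).trans ?_
      · refine mul_le_mul_of_nonneg_left (Real.exp_le_exp.2 ?_) hM0
        have := mul_le_mul_of_nonneg_left (neg_le_abs x) ha
        linarith
      · rw [abs_of_nonpos hx] at hk ⊢
        refine mul_le_mul_of_nonneg_left (Real.exp_le_exp.2 ?_) hM0
        linarith
  -- The lower half of the strip follows by applying the upper half to `w ↦ F (-w)`.
  rcases le_total 0 z.im with h0 | h0
  · exact upper hF hM hR z h0 ((le_abs_self _).trans hz)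
  · have h := upper (G := fun w => F (-w)) (fun w hw => ?_) (fun w hw => hM (-w) (by simpa using hw))
      (fun x => by simpa using hR (-x)) (-z) (by simpa using h0)
      (by simpa using (neg_le_abs _).trans hz)
    · simpa using h
    · exact (hF (-w) (by simpa using hw)).comp w differentiableWithinAt_id.neg
        (fun v hv => by simpa using hv)

/-- The holomorphic extension of a function with exponentially decaying Fourier transform. -/
theorem exists_holomorphic_extension {φ : ℝ → ℂ} (hφ : AEStronglyMeasurable φ) {C b : ℝ}
    (hb : 0 < b) (hφb : ∀ ξ, ‖φ ξ‖ ≤ C * Real.exp (-b * |ξ|)) :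
    DifferentiableOn ℂ (fun z : ℂ => ∫ ξ : ℝ, φ ξ * Complex.exp (2 * Real.pi * Complex.I * ξ * z))
      {z | |z.im| < b / (4 * Real.pi)} ∧
    ∀ z : ℂ, |z.im| < b / (4 * Real.pi) →
      ‖∫ ξ : ℝ, φ ξ * Complex.exp (2 * Real.pi * Complex.I * ξ * z)‖ ≤
        C * ∫ ξ : ℝ, Real.exp (-(b / 2) * |ξ|) := by
  have hpi := Real.pi_pos
  have hC0 : 0 ≤ C := by simpa using (norm_nonneg _).trans (hφb 0)
  -- In this strip the exponential grows at most like `exp (b / 2 * |ξ|)`, so half of the decay of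
  -- `φ` survives.
  have hbd : ∀ z : ℂ, |z.im| < b / (4 * Real.pi) → ∀ ξ : ℝ,
      ‖φ ξ * Complex.exp (2 * Real.pi * Complex.I * ξ * z)‖ ≤
        C * Real.exp (-(b / 2) * |ξ|) := by
    intro z hz ξ
    have hre : (2 * Real.pi * Complex.I * ξ * z : ℂ).re = -(2 * Real.pi * (ξ * z.im)) := by
      simp [Complex.mul_re, Complex.mul_im]; ring
    rw [norm_mul, Complex.norm_exp, hre]
    rw [lt_div_iff₀ (by positivity)] at hz
    calc _ ≤ C * Real.exp (-b * |ξ|) * Real.exp (b / 2 * |ξ|) := by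
          gcongr
          · exact hφb ξ
          · have h1 : -(ξ * z.im) ≤ |ξ| * |z.im| := by rw [← abs_mul]; exact neg_le_abs _
            nlinarith [abs_nonneg ξ]
      _ = _ := by rw [mul_assoc, ← Real.exp_add]; congr 2; ring
  have hmeas : ∀ z : ℂ, AEStronglyMeasurable
      (fun ξ : ℝ => φ ξ * Complex.exp (2 * Real.pi * Complex.I * ξ * z)) := fun z =>
    hφ.mul (Continuous.aestronglyMeasurable (by fun_prop))
  have hint : Integrable (fun ξ : ℝ => C * Real.exp (-(b / 2) * |ξ|)) :=
    (integrable_exp_neg_abs (half_pos hb)).const_mul C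
  refine ⟨fun z₀ hz₀ => ?_, fun z hz => ?_⟩
  · have hUo : IsOpen {z : ℂ | |z.im| < b / (4 * Real.pi)} :=
      isOpen_lt (continuous_abs.comp Complex.continuous_im) continuous_const
    refine (hasDerivAt_integral_of_dominated_loc_of_deriv_le (𝕜 := ℂ) (μ := volume)
      (F := fun z ξ => φ ξ * Complex.exp (2 * Real.pi * Complex.I * ξ * z))
      (F' := fun z ξ => φ ξ * Complex.exp (2 * Real.pi * Complex.I * ξ * z) *
        (2 * Real.pi * Complex.I * ξ))
      -- The factor `ξ` produced by differentiation is paid for with another `b / 4` of the decay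
      -- rate.
      (bound := fun ξ => C * (8 * Real.pi / b) * Real.exp (-(b / 4) * |ξ|))
      (hUo.mem_nhds hz₀) (Filter.Eventually.of_forall hmeas)
      (hint.mono' (hmeas z₀) (Filter.Eventually.of_forall (hbd z₀ hz₀)))
      ((hmeas z₀).mul (Continuous.aestronglyMeasurable (by fun_prop)))
      (Filter.Eventually.of_forall fun ξ z hz => ?_)
      ((integrable_exp_neg_abs (by positivity)).const_mul _)
      (Filter.Eventually.of_forall fun ξ z hz => ?_)).2.differentiableAt.differentiableWithinAt
    · rw [norm_mul]
      have h1 : ‖(2 * Real.pi * Complex.I * ξ : ℂ)‖ = 2 * Real.pi * |ξ| := by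
        simp [abs_of_pos hpi]
      have h2 : |ξ| ≤ 4 / b * Real.exp (b / 4 * |ξ|) := by
        have := Real.add_one_le_exp (b / 4 * |ξ|)
        rw [div_mul_eq_mul_div, le_div_iff₀ hb]
        linarith
      rw [h1]
      calc _ ≤ C * Real.exp (-(b / 2) * |ξ|) *
            (2 * Real.pi * (4 / b * Real.exp (b / 4 * |ξ|))) := by
            gcongr
            exact hbd z hz ξ
        _ = C * (8 * Real.pi / b) * (Real.exp (-(b / 2) * |ξ|) * Real.exp (b / 4 * |ξ|)) := by
            ring
        _ = _ := by rw [← Real.exp_add]; congr 2; ring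
    · have h1 : HasDerivAt (fun z : ℂ => 2 * Real.pi * Complex.I * ξ * z)
          (2 * Real.pi * Complex.I * ξ) z := by
        simpa using (hasDerivAt_id z).const_mul (2 * Real.pi * Complex.I * ξ : ℂ)
      simpa [mul_assoc] using h1.cexp.const_mul (φ ξ)
  · rw [← integral_const_mul]
    exact norm_integral_le_of_norm_le hint (Filter.Eventually.of_forall (hbd z hz))

/-- The generator of a Wilson basis and its derivatives satisfy analytic bounds with exponential
decay. -/
theorem IsWilsonGenerator.exists_derivatives {ψ : ℝ → ℝ} (hψ : IsWilsonGenerator ψ) :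
    ∃ (Ψ : ℕ → ℝ → ℂ) (C a H : ℝ), 0 < C ∧ 0 < a ∧ 0 < H ∧ (∀ x, Ψ 0 x = ψ x) ∧
      (∀ m x, HasDerivAt (Ψ m) (Ψ (m + 1) x) x) ∧
      ∀ m x, ‖Ψ m x‖ ≤ C * (H ^ m * m.factorial) * Real.exp (-a * |x|) := by
  obtain ⟨C, a, b, hC, ha, hb, h1, h2⟩ := hψ.decay
  have hpi := Real.pi_pos
  set f : ℝ → ℂ := fun x => (ψ x : ℂ) with hf
  have hfc : Continuous f := Complex.continuous_ofReal.comp hψ.continuous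
  have hfi : Integrable f := by
    refine ((integrable_exp_neg_abs ha).const_mul C).mono' hfc.aestronglyMeasurable
      (Filter.Eventually.of_forall fun x => ?_)
    simpa [hf] using h1 x
  have hFc : Continuous (𝓕 f) :=
    VectorFourier.fourierIntegral_continuous Real.continuous_fourierChar
      (by exact continuous_inner) hfi
  have hFi : Integrable (𝓕 f) :=
    ((integrable_exp_neg_abs hb).const_mul C).mono' hFc.aestronglyMeasurable
      (Filter.Eventually.of_forall h2)
  obtain ⟨hd, hbd⟩ := exists_holomorphic_extension hFc.aestronglyMeasurable hb h2
  set F : ℂ → ℂ := fun z => ∫ ξ : ℝ, 𝓕 f ξ * Complex.exp (2 * Real.pi * Complex.I * ξ * z) with hFdef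
  -- Fourier inversion; continuity of the window makes it hold at every point.
  have hFx : ∀ x : ℝ, F x = f x := by
    intro x
    rw [← congrFun (hfc.fourierInv_fourier_eq hfi hFi) x, Real.fourierInv_eq']
    refine integral_congr_ae (Filter.Eventually.of_forall fun ξ => ?_)
    simp only [smul_eq_mul, RCLike.inner_apply, conj_trivial]
    rw [mul_comm]
    congr 2
    push_cast
    ring
  set b₀ := b / (4 * Real.pi) with hb₀
  have hb₀pos : 0 < b₀ := by positivity
  set M := max C (C * ∫ ξ : ℝ, Real.exp (-(b / 2) * |ξ|)) with hM
  have hM0 : 0 < M := lt_max_of_lt_left hC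
  -- Holomorphy holds for `|Im z| < b₀` and the strip estimate is used with width `b₀ / 2`, which
  -- leaves room for Cauchy discs of radius `b₀ / 4` around real points.
  have hstrip : ∀ z : ℂ, |z.im| ≤ b₀ / 4 → ‖F z‖ ≤ M * Real.exp (-(a / 2 * |z.re|)) := by
    intro z hz
    refine norm_le_exp_abs_of_strip (b := b₀ / 2) ha.le (by positivity) (by linarith) hd
      (fun z hz => (hbd z hz).trans (le_max_right _ _)) (fun x => ?_) (by linarith)
    rw [hFx, ← neg_mul]
    calc ‖f x‖ ≤ C * Real.exp (-a * |x|) := by simpa [hf] using h1 x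
      _ ≤ _ := by gcongr; exact le_max_left _ _
  have hUo : IsOpen {z : ℂ | |z.im| < b₀} :=
    isOpen_lt (continuous_abs.comp Complex.continuous_im) continuous_const
  have hdiff : ∀ m, DifferentiableOn ℂ (iteratedDeriv m F) {z | |z.im| < b₀} := by
    intro m
    induction m with
    | zero => simpa using hd
    | succ m ih => rw [iteratedDeriv_succ]; exact ih.deriv hUo
  have hreal : ∀ x : ℝ, (x : ℂ) ∈ {z : ℂ | |z.im| < b₀} := fun x => by simpa using hb₀pos
  refine ⟨fun m x => iteratedDeriv m F x, M * Real.exp (a / 2 * (b₀ / 4)), a / 2, (b₀ / 4)⁻¹,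
    by positivity, by positivity, by positivity, fun x => by simp [hFx, hf], fun m x => ?_,
    fun m x => ?_⟩
  · have h := ((hdiff m _ (hreal x)).differentiableAt (hUo.mem_nhds (hreal x))).hasDerivAt
    rw [← iteratedDeriv_succ] at h
    exact h.comp_ofReal
  · have hsub : ∀ z ∈ Metric.closedBall (x : ℂ) (b₀ / 4), |z.im| ≤ b₀ / 4 ∧ |x - z.re| ≤ b₀ / 4 := by
      intro z hz
      rw [mem_closedBall_iff_norm] at hz
      have h3 := (Complex.abs_im_le_norm (z - x)).trans hz
      have h4 := (Complex.abs_re_le_norm (z - x)).trans hz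
      simp only [Complex.sub_im, Complex.ofReal_im, sub_zero] at h3
      simp only [Complex.sub_re, Complex.ofReal_re] at h4
      exact ⟨h3, by rwa [abs_sub_comm]⟩
    have hcl : DiffContOnCl ℂ F (Metric.ball (x : ℂ) (b₀ / 4)) := by
      refine DifferentiableOn.diffContOnCl (hd.mono fun z hz => ?_)
      have := (hsub z (Metric.closure_ball_subset_closedBall hz)).1
      exact this.trans_lt (by linarith)
    have h := Complex.norm_iteratedDeriv_le_of_forall_mem_sphere_norm_le m
      (by positivity : 0 < b₀ / 4) hcl (C := M * Real.exp (a / 2 * (b₀ / 4)) *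
        Real.exp (-(a / 2) * |x|)) (fun z hz => ?_)
    · refine h.trans_eq ?_
      rw [inv_pow]
      field_simp
    · obtain ⟨h3, h4⟩ := hsub z (Metric.sphere_subset_closedBall hz)
      refine (hstrip z h3).trans ?_
      rw [mul_assoc, ← Real.exp_add]
      gcongr
      have h5 : |x| ≤ |x - z.re| + |z.re| := by
        simpa using abs_add_le (x - z.re) z.re
      nlinarith

/-! ### Jets: families of iterated partial derivatives. -/

/-- The linear form on `ℝ^d` with coefficients `v`. -/
def linForm {d : ℕ} (v : Fin d → ℂ) : E d →L[ℝ] ℂ :=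
  ∑ i, (EuclideanSpace.proj i : E d →L[ℝ] ℝ).smulRight (v i)

theorem linForm_apply {d : ℕ} (v : Fin d → ℂ) (y : E d) : linForm v y = ∑ i, y i • v i := by
  simp [linForm]

theorem norm_linForm_le {d : ℕ} (v : Fin d → ℂ) : ‖linForm v‖ ≤ ∑ i, ‖v i‖ := by
  refine ContinuousLinearMap.opNorm_le_bound _ (by positivity) fun y => ?_
  rw [linForm_apply, Finset.sum_mul]
  refine norm_sum_le_of_le _ fun i _ => ?_
  rw [norm_smul, mul_comm]
  gcongr
  exact PiLp.norm_apply_le y i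

theorem hasSum_linForm {d : ℕ} {ι : Type*} {v : ι → Fin d → ℂ} {w : Fin d → ℂ}
    (h : ∀ i, HasSum (fun p => v p i) (w i)) : HasSum (fun p => linForm (v p)) (linForm w) := by
  refine hasSum_sum fun i _ => ?_
  exact (h i).mapL (ContinuousLinearMap.smulRightL ℝ (E d) ℂ (EuclideanSpace.proj i))

/-- A family of functions indexed by multi-indices, in which `F (β + e_i)` is the `i`-th partial
derivative of `F β`. -/
def IsJet {d : ℕ} (F : (Fin d → ℕ) → E d → ℂ) : Prop :=
  ∀ β x, HasFDerivAt (F β) (linForm fun i => F (β + Pi.single i 1) x) x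

namespace IsJet

variable {d : ℕ} {F G : (Fin d → ℕ) → E d → ℂ}

theorem contDiff (hF : IsJet F) (β : Fin d → ℕ) : ContDiff ℝ ∞ (F β) := by
  refine contDiff_infty.2 fun n => ?_
  induction n generalizing β with
  | zero =>
    refine contDiff_zero.2 (continuous_iff_continuousAt.2 fun x => (hF β x).continuousAt)
  | succ n ih =>
    refine contDiff_succ_iff_hasFDerivAt.2
      ⟨fun x => linForm fun i => F (β + Pi.single i 1) x, ?_, hF β⟩
    unfold linForm
    exact ContDiff.sum fun i _ => contDiff_const.smulRight (ih _)

theorem pderiv_eq (hF : IsJet F) (i : Fin d) (β : Fin d → ℕ) :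
    pderiv i (F β) = F (β + Pi.single i 1) := by
  funext x
  rw [pderiv, (hF β x).fderiv, linForm_apply, Finset.sum_eq_single i]
  · simp
  · intro j _ hj
    simp [hj]
  · simp

theorem pderiv_iterate_eq (hF : IsJet F) (i : Fin d) (k : ℕ) (β : Fin d → ℕ) :
    (pderiv i)^[k] (F β) = F (β + Pi.single i k) := by
  induction k with
  | zero => simp
  | succ k ih =>
    rw [Function.iterate_succ_apply', ih, hF.pderiv_eq, add_assoc, ← Pi.single_add]

/-- This lets every later estimate work with explicit formulas for the jet in place of the iterated
`fderiv` in the definition of `mderiv`. -/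
theorem mderiv_eq (hF : IsJet F) (β : Fin d → ℕ) : mderiv β (F 0) = F β := by
  have key : ∀ L : List (Fin d), L.foldr (fun i g => (pderiv i)^[β i] g) (F 0) =
      F (L.map fun i => Pi.single i (β i)).sum := by
    intro L
    induction L with
    | nil => simp
    | cons i L ih => rw [List.foldr_cons, ih, hF.pderiv_iterate_eq, List.map_cons, List.sum_cons,
        add_comm]
  rw [mderiv, key, ← Fin.sum_univ_def, Finset.univ_sum_single]

theorem sub (hF : IsJet F) (hG : IsJet G) : IsJet fun β x => F β x - G β x := by
  intro β x
  convert! (hF β x).sub (hG β x) using 1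
  ext y
  simp [linForm_apply, mul_sub]

theorem const_mul (hF : IsJet F) (c : ℂ) : IsJet fun β x => c * F β x := by
  intro β x
  convert! (hF β x).const_mul c using 1
  ext y
  simp only [linForm_apply, smul_apply, Finset.mul_sum, smul_eq_mul,
    Complex.real_smul]
  exact Finset.sum_congr rfl fun i _ => by ring

theorem sum {ι : Type*} (S : Finset ι) {J : ι → (Fin d → ℕ) → E d → ℂ}
    (hJ : ∀ p, IsJet (J p)) : IsJet fun β x => ∑ p ∈ S, J p β x := by
  intro β x
  convert! HasFDerivAt.fun_sum fun p (_ : p ∈ S) => hJ p β x using 1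
  ext y
  simp only [linForm_apply, _root_.sum_apply, Finset.smul_sum]
  exact Finset.sum_comm

/-- Termwise differentiation by the Weierstrass test, with a separate majorant for each multi-index.
-/
theorem tsum {ι : Type*} {J : ι → (Fin d → ℕ) → E d → ℂ} (hJ : ∀ p, IsJet (J p))
    (hb : ∀ β, ∃ u : ι → ℝ, Summable u ∧ ∀ p x, ‖J p β x‖ ≤ u p) :
    IsJet fun β x => ∑' p, J p β x := by
  choose u hu hJu using hb
  intro β x
  have hs : ∀ β x, HasSum (fun p => J p β x) (∑' p, J p β x) := fun β x =>
    (Summable.of_norm_bounded (hu β) fun p => hJu β p x).hasSum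
  have h := hasFDerivAt_tsum (f := fun p => J p β)
    (f' := fun p x => linForm fun i => J p (β + Pi.single i 1) x)
    (u := fun p => ∑ i, u (β + Pi.single i 1) p) (x₀ := x)
    (summable_sum fun i _ => hu _) (fun p x => hJ p β x)
    (fun p x => (norm_linForm_le _).trans (Finset.sum_le_sum fun i _ => hJu _ p x))
    (hs β x).summable x
  exact h.congr_fderiv (hasSum_linForm fun i => hs (β + Pi.single i 1) x).tsum_eq

/-- Tensor products of one-dimensional families of derivatives. -/
theorem tensor {g : Fin d → ℕ → ℝ → ℂ} (hg : ∀ k m t, HasDerivAt (g k m) (g k (m + 1) t) t) :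
    IsJet fun (β : Fin d → ℕ) (x : E d) => ∏ k, g k (β k) (x k) := by
  intro β x
  have h1 : ∀ k ∈ (Finset.univ : Finset (Fin d)), HasFDerivAt (fun x : E d => g k (β k) (x k))
      ((EuclideanSpace.proj k : E d →L[ℝ] ℝ).smulRight (g k (β k + 1) (x k))) x := by
    intro k _
    exact (hg k (β k) (x k)).hasFDerivAt.comp x (EuclideanSpace.proj k : E d →L[ℝ] ℝ).hasFDerivAt
  convert! HasFDerivAt.finsetProd h1 using 1
  unfold linForm
  refine Finset.sum_congr rfl fun i _ => ?_
  ext y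
  simp only [ContinuousLinearMap.smulRight_apply, smul_apply, smul_eq_mul,
    Complex.real_smul]
  rw [← Finset.mul_prod_erase _ _ (Finset.mem_univ i)]
  have h2 : ∏ k ∈ Finset.univ.erase i, g k ((β + Pi.single i 1 : Fin d → ℕ) k) (x k) =
      ∏ k ∈ Finset.univ.erase i, g k (β k) (x k) :=
    Finset.prod_congr rfl fun k hk => by simp [(Finset.mem_erase.1 hk).1]
  rw [h2]
  simp
  ring

end IsJet

/-! ### Pointwise form of the norms, window families and modulated windows. -/

theorem gsENorm_le_iff {d : ℕ} {s h N : ℝ} (hh : 0 < h) (hN : 0 ≤ N) (f : E d → ℂ) :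
    gsENorm s h f ≤ ENNReal.ofReal N ↔
      ∀ α β x, |monomial α x| * ‖mderiv β f x‖ ≤ N * gsDenom s h α β := by
  simp only [gsENorm, iSup_le_iff]
  refine forall_congr' fun α => forall_congr' fun β => forall_congr' fun x => ?_
  rw [ENNReal.ofReal_le_ofReal_iff hN, div_le_iff₀ (gsDenom_pos s hh α β), norm_mul,
    Complex.norm_real, Real.norm_eq_abs]

theorem exists_gsENorm_le {d : ℕ} {s h : ℝ} {f : E d → ℂ} (hf : gsENorm s h f < ⊤) :
    ∃ N : ℝ, 0 ≤ N ∧ gsENorm s h f ≤ ENNReal.ofReal N :=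
  ⟨_, ENNReal.toReal_nonneg, (ENNReal.ofReal_toReal hf.ne).ge⟩

theorem gsDenom_eq_prod {d : ℕ} (s h : ℝ) (α β : Fin d → ℕ) :
    gsDenom s h α β =
      ∏ i, h ^ (α i + β i) * (((α i).factorial : ℝ) ^ s * ((β i).factorial : ℝ) ^ s) := by
  unfold gsDenom
  rw [Finset.prod_mul_distrib, Finset.prod_pow_eq_pow_sum, Finset.prod_mul_distrib]
  push_cast
  rw [Real.mul_rpow (by positivity) (by positivity), Real.finsetProd_rpow _ _ (by simp),
    Real.finsetProd_rpow _ _ (by simp)]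

/-- `Ψ k m` is the `m`-th derivative of the window `ψ k`, and all of them satisfy common analytic
bounds with exponential decay. -/
structure IsWindowFamily {d : ℕ} (ψ : Fin d → ℝ → ℝ) (Ψ : Fin d → ℕ → ℝ → ℂ) (C a H : ℝ) :
    Prop where
  C_pos : 0 < C
  a_pos : 0 < a
  H_pos : 0 < H
  zero : ∀ k x, Ψ k 0 x = ψ k x
  hasDerivAt : ∀ k m x, HasDerivAt (Ψ k m) (Ψ k (m + 1) x) x
  bound : ∀ k m x, ‖Ψ k m x‖ ≤ C * (H ^ m * m.factorial) * Real.exp (-a * |x|)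

theorem exists_isWindowFamily {d : ℕ} {ψ : Fin d → ℝ → ℝ} (hψ : ∀ k, IsWilsonGenerator (ψ k)) :
    ∃ Ψ C a H, IsWindowFamily ψ Ψ C a H := by
  choose Ψ C a H hC ha hH h0 hd hb using fun k => (hψ k).exists_derivatives
  have hle : ∀ (f : Fin d → ℝ), (∀ k, 0 < f k) → ∀ k, f k ≤ 1 + ∑ j, f j := fun f hf k => by
    have := Finset.single_le_sum (f := f) (fun j _ => (hf j).le) (Finset.mem_univ k)
    linarith
  have hpos : ∀ (f : Fin d → ℝ), (∀ k, 0 < f k) → 0 < 1 + ∑ j, f j := fun f hf => by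
    have := Finset.sum_nonneg fun j (_ : j ∈ Finset.univ) => (hf j).le
    linarith
  have hai : ∀ k, 0 < (a k)⁻¹ := fun k => inv_pos.2 (ha k)
  -- Sums replace maxima and minima; the added 1 keeps the constants positive when `d = 0`.
  refine ⟨Ψ, 1 + ∑ j, C j, (1 + ∑ j, (a j)⁻¹)⁻¹, 1 + ∑ j, H j, hpos C hC, inv_pos.2 (hpos _ hai),
    hpos H hH, h0, hd, fun k m x => (hb k m x).trans ?_⟩
  have h1 : (1 + ∑ j, (a j)⁻¹)⁻¹ ≤ a k := by
    rw [inv_le_comm₀ (hpos _ hai) (ha k)]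
    exact hle _ hai k
  have h2 := hle C hC k
  have h3 := hle H hH k
  have h4 := hC k
  have h5 := hH k
  have h6 := hpos H hH
  have h7 := hpos C hC
  gcongr

/-- Derivatives of `x ↦ cos (κ x + θ) Ψ_m (x - μ)`; the first index is the order of the derivative. -/
def modulated (κ μ : ℝ) (Ψ : ℕ → ℝ → ℂ) : ℕ → ℕ → ℝ → ℝ → ℂ
  | 0, m, θ, x => (Real.cos (κ * x + θ) : ℂ) * Ψ m (x - μ)
  | q + 1, m, θ, x =>
    κ * modulated κ μ Ψ q m (θ + Real.pi / 2) x + modulated κ μ Ψ q (m + 1) θ x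

theorem hasDerivAt_cos_phase (κ θ x : ℝ) :
    HasDerivAt (fun x : ℝ => (Real.cos (κ * x + θ) : ℂ))
      (κ * (Real.cos (κ * x + (θ + Real.pi / 2)) : ℂ)) x := by
  have h1 : HasDerivAt (fun x : ℝ => κ * x + θ) κ x := by
    simpa using ((hasDerivAt_id x).const_mul κ).add_const θ
  have h2 := h1.cos.ofReal_comp
  convert! h2 using 1
  rw [← add_assoc, Real.cos_add_pi_div_two]
  push_cast
  ring

theorem hasDerivAt_modulated {Ψ : ℕ → ℝ → ℂ} (hΨ : ∀ m x, HasDerivAt (Ψ m) (Ψ (m + 1) x) x)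
    (κ μ : ℝ) (q m : ℕ) (θ x : ℝ) :
    HasDerivAt (modulated κ μ Ψ q m θ) (modulated κ μ Ψ (q + 1) m θ x) x := by
  induction q generalizing m θ with
  | zero =>
    have h1 : HasDerivAt (fun x => Ψ m (x - μ)) (Ψ (m + 1) (x - μ)) x :=
      (hΨ m (x - μ)).comp_sub_const x μ
    have h2 := (hasDerivAt_cos_phase κ θ x).mul h1
    simp only [modulated]
    convert! h2 using 1
    ring
  | succ q ih => exact ((ih m (θ + Real.pi / 2)).const_mul (κ : ℂ)).add (ih (m + 1) θ)

/-- Each derivative falls on the cosine, raising `r`, or on the window, raising `m`. Carrying the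
factor `κ ^ r` through the induction keeps the total order `q + m + r` fixed, so the `2 ^ q` terms
share one bound and no binomial sums appear. -/
theorem pow_mul_norm_modulated_le {Ψ : ℕ → ℝ → ℂ} {s ε κ μ C K a : ℝ} (hs : 0 ≤ s) (hε : 0 < ε)
    (hκ : 0 ≤ κ) (hC : 0 ≤ C)
    (hΨ : ∀ m y, ‖Ψ m y‖ ≤ C * (ε ^ m * (m.factorial : ℝ) ^ s) * Real.exp (-a * |y|))
    (hK : ∀ r : ℕ, κ ^ r ≤ K * (ε ^ r * (r.factorial : ℝ) ^ s)) (q m r : ℕ) (θ x : ℝ) :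
    κ ^ r * ‖modulated κ μ Ψ q m θ x‖ ≤ 2 ^ q * (C * K *
      (ε ^ (q + m + r) * ((q + m + r).factorial : ℝ) ^ s) * Real.exp (-a * |x - μ|)) := by
  have hK0 : 0 ≤ K := by simpa using zero_le_one.trans (hK 0)
  induction q generalizing m r θ with
  | zero =>
    rw [modulated, norm_mul, Complex.norm_real, Real.norm_eq_abs]
    calc κ ^ r * (|Real.cos (κ * x + θ)| * ‖Ψ m (x - μ)‖)
        ≤ (K * (ε ^ r * (r.factorial : ℝ) ^ s)) *
          (1 * (C * (ε ^ m * (m.factorial : ℝ) ^ s) * Real.exp (-a * |x - μ|))) := by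
          gcongr
          · exact hK r
          · exact Real.abs_cos_le_one _
          · exact hΨ m _
      _ = C * K * (ε ^ (m + r) * ((m.factorial : ℝ) ^ s * (r.factorial : ℝ) ^ s)) *
          Real.exp (-a * |x - μ|) := by ring
      _ ≤ C * K * (ε ^ (m + r) * ((m + r).factorial : ℝ) ^ s) * Real.exp (-a * |x - μ|) := by
          gcongr
          exact factorial_rpow_mul_le hs m r
      _ = _ := by simp
  | succ q ih =>
    rw [modulated]
    have h1 := ih m (r + 1) (θ + Real.pi / 2)
    have h2 := ih (m + 1) r θ
    rw [show q + m + (r + 1) = q + 1 + m + r by ring] at h1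
    rw [show q + (m + 1) + r = q + 1 + m + r by ring] at h2
    calc κ ^ r * ‖κ * modulated κ μ Ψ q m (θ + Real.pi / 2) x + modulated κ μ Ψ q (m + 1) θ x‖
        ≤ κ ^ r * (κ * ‖modulated κ μ Ψ q m (θ + Real.pi / 2) x‖ +
          ‖modulated κ μ Ψ q (m + 1) θ x‖) := by
          gcongr
          refine (norm_add_le _ _).trans_eq ?_
          rw [norm_mul, Complex.norm_real, Real.norm_of_nonneg hκ]
      _ = κ ^ (r + 1) * ‖modulated κ μ Ψ q m (θ + Real.pi / 2) x‖ +
          κ ^ r * ‖modulated κ μ Ψ q (m + 1) θ x‖ := by ring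
      _ ≤ _ := add_le_add h1 h2
      _ = _ := by ring

/-! ### Amplitude, phase and centre of the Wilson functions -/

/-- The amplitude of `ψ_{l,n}`. -/
def wilsonAmp (l : ℕ) : ℝ := if l = 0 then 1 else √2

/-- The phase of `ψ_{l,n}`. -/
def wilsonPhase (l : ℕ) (n : ℤ) : ℝ :=
  if l = 0 ∨ Even ((l : ℤ) + n) then 0 else -(Real.pi / 2)

/-- The point around which `ψ_{l,n}` is localized. -/
def wilsonCenter (l : ℕ) (n : ℤ) : ℝ := if l = 0 then n else n / 2

theorem wilson1_eq (ψ : ℝ → ℝ) (l : ℕ) (n : ℤ) (x : ℝ) :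
    wilson1 ψ l n x = wilsonAmp l * Real.cos (2 * Real.pi * l * x + wilsonPhase l n) *
      ψ (x - wilsonCenter l n) := by
  unfold wilson1 wilsonAmp wilsonPhase wilsonCenter
  by_cases hl : l = 0
  · simp [hl]
  · by_cases he : Even ((l : ℤ) + n)
    · simp [hl, he]
    · simp only [hl, he, if_false, or_self]
      rw [← sub_eq_add_neg, Real.cos_sub_pi_div_two]

theorem wilsonAmp_nonneg (l : ℕ) : 0 ≤ wilsonAmp l := by
  unfold wilsonAmp; split_ifs <;> positivity

theorem wilsonAmp_le (l : ℕ) : wilsonAmp l ≤ 2 := by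
  unfold wilsonAmp
  split_ifs
  · norm_num
  · exact Real.sqrt_le_iff.2 (by norm_num)

theorem abs_half_le_abs_wilsonCenter (l : ℕ) (n : ℤ) : |(n : ℝ) / 2| ≤ |wilsonCenter l n| := by
  unfold wilsonCenter
  split_ifs
  · rw [abs_div, abs_two]; linarith [abs_nonneg (n : ℝ)]
  · exact le_rfl

theorem abs_wilsonCenter_le (l : ℕ) (n : ℤ) : |wilsonCenter l n| ≤ 2 * |(n : ℝ) / 2| := by
  unfold wilsonCenter
  rw [abs_div, abs_two]
  split_ifs
  · linarith
  · rw [abs_div, abs_two]; linarith [abs_nonneg (n : ℝ)]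

theorem idxSize_nonneg {d : ℕ} (p : Idx d) : 0 ≤ idxSize p := by
  unfold idxSize; positivity

theorem fst_le_idxSize {d : ℕ} (p : Idx d) (k : Fin d) : (p.1 k : ℝ) ≤ idxSize p := by
  have h := PiLp.norm_apply_le (WithLp.toLp 2 (fun i => (p.1 i : ℝ)) : E d) k
  simp only [Real.norm_eq_abs, Nat.abs_cast] at h
  unfold idxSize
  linarith [norm_nonneg (WithLp.toLp 2 (fun i => (p.2 i : ℝ) / 2) : E d)]

theorem abs_snd_le_idxSize {d : ℕ} (p : Idx d) (k : Fin d) : |(p.2 k : ℝ) / 2| ≤ idxSize p := by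
  have h := PiLp.norm_apply_le (WithLp.toLp 2 (fun i => (p.2 i : ℝ) / 2) : E d) k
  simp only [Real.norm_eq_abs] at h
  unfold idxSize
  linarith [norm_nonneg (WithLp.toLp 2 (fun i => (p.1 i : ℝ)) : E d)]

/-! ### Gelfand–Shilov bounds for the Wilson functions. -/

/-- The derivatives of a one-dimensional Wilson function. -/
def wilson1Deriv (Ψ : ℕ → ℝ → ℂ) (l : ℕ) (n : ℤ) (q : ℕ) (x : ℝ) : ℂ :=
  wilsonAmp l * modulated (2 * Real.pi * l) (wilsonCenter l n) Ψ q 0 (wilsonPhase l n) x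

/-- The partial derivatives of a Wilson function. -/
def wilsonJet {d : ℕ} (Ψ : Fin d → ℕ → ℝ → ℂ) (p : Idx d) (β : Fin d → ℕ) (x : E d) : ℂ :=
  ∏ k, wilson1Deriv (Ψ k) (p.1 k) (p.2 k) (β k) (x k)

theorem add_abs_pow_le (x y : ℝ) (m : ℕ) : |x + y| ^ m ≤ 2 ^ m * (|x| ^ m + |y| ^ m) := by
  have h1 : |x + y| ≤ 2 * max |x| |y| := by
    linarith [abs_add_le x y, le_max_left |x| |y|, le_max_right |x| |y|]
  calc |x + y| ^ m ≤ (2 * max |x| |y|) ^ m := by gcongr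
    _ = 2 ^ m * max |x| |y| ^ m := mul_pow _ _ _
    _ ≤ _ := by
      gcongr
      rcases max_choice |x| |y| with h | h <;> rw [h]
      · linarith [pow_nonneg (abs_nonneg y) m]
      · linarith [pow_nonneg (abs_nonneg x) m]

theorem exists_pow_mul_exp_le {s ε a : ℝ} (hs : 1 < s) (hε : 0 < ε) (ha : 0 < a) :
    ∃ C : ℝ, 0 < C ∧ ∀ (m : ℕ) (y : ℝ), |y| ^ m * Real.exp (-a * |y|) ≤
      C * (ε ^ m * (m.factorial : ℝ) ^ s) := by
  obtain ⟨C, hC, h⟩ := exists_analytic_le_gevrey hs (inv_pos.2 ha) hε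
  refine ⟨C, hC, fun m y => le_trans ?_ (h m)⟩
  have h1 := pow_le_exp_mul_factorial (mul_nonneg ha.le (abs_nonneg y)) m
  rw [neg_mul, Real.exp_neg, ← div_eq_mul_inv, div_le_iff₀ (Real.exp_pos _), inv_pow,
    inv_mul_eq_div, div_mul_eq_mul_div, le_div_iff₀ (by positivity)]
  rw [mul_pow] at h1
  linarith

namespace IsWindowFamily

variable {d : ℕ} {ψ : Fin d → ℝ → ℝ} {Ψ : Fin d → ℕ → ℝ → ℂ} {C a H : ℝ}

theorem wilson1Deriv_zero (hΨ : IsWindowFamily ψ Ψ C a H) (k : Fin d) (l : ℕ) (n : ℤ) (x : ℝ) :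
    wilson1Deriv (Ψ k) l n 0 x = wilson1 (ψ k) l n x := by
  rw [wilson1Deriv, modulated, hΨ.zero, wilson1_eq]
  push_cast
  ring

theorem hasDerivAt_wilson1Deriv (hΨ : IsWindowFamily ψ Ψ C a H) (k : Fin d) (l : ℕ) (n : ℤ)
    (q : ℕ) (x : ℝ) :
    HasDerivAt (wilson1Deriv (Ψ k) l n q) (wilson1Deriv (Ψ k) l n (q + 1) x) x :=
  (hasDerivAt_modulated (hΨ.hasDerivAt k) _ _ _ _ _ _).const_mul _

theorem isJet_wilsonJet (hΨ : IsWindowFamily ψ Ψ C a H) (p : Idx d) : IsJet (wilsonJet Ψ p) :=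
  IsJet.tensor fun k m t => hΨ.hasDerivAt_wilson1Deriv k (p.1 k) (p.2 k) m t

theorem wilsonJet_zero (hΨ : IsWindowFamily ψ Ψ C a H) (p : Idx d) :
    wilsonJet Ψ p 0 = wilson ψ p := by
  funext x
  exact Finset.prod_congr rfl fun k _ => hΨ.wilson1Deriv_zero k _ _ _

theorem mderiv_wilson (hΨ : IsWindowFamily ψ Ψ C a H) (p : Idx d) (β : Fin d → ℕ) :
    mderiv β (wilson ψ p) = wilsonJet Ψ p β := by
  rw [← hΨ.wilsonJet_zero, (hΨ.isJet_wilsonJet p).mderiv_eq]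

/-- Gevrey bounds of arbitrarily small radius for the windows. -/
theorem exists_gevrey_bound (hΨ : IsWindowFamily ψ Ψ C a H) {s ε : ℝ} (hs : 1 < s) (hε : 0 < ε) :
    ∃ C' : ℝ, 0 < C' ∧ ∀ k m y,
      ‖Ψ k m y‖ ≤ C' * (ε ^ m * (m.factorial : ℝ) ^ s) * Real.exp (-a * |y|) := by
  obtain ⟨C', hC', h⟩ := exists_analytic_le_gevrey hs hΨ.H_pos hε
  have hC := hΨ.C_pos
  refine ⟨C * C', mul_pos hC hC', fun k m y => (hΨ.bound k m y).trans ?_⟩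
  rw [mul_assoc C C']
  exact mul_le_mul_of_nonneg_right (mul_le_mul_of_nonneg_left (h m) hC.le) (Real.exp_pos _).le

/-- The derivatives cost powers of the frequency, and `|x| ^ j` costs powers of the centre once `x`
is split as `(x - μ) + μ`. Both quantities are at most `2πσ`, so each contributes one factor `Λ`;
hence `2 * s` in the exponent. Gevrey radius `h / 2` absorbs the factors `2 ^ q` and `2 ^ j`. -/
theorem exists_wilson1Deriv_bound (hΨ : IsWindowFamily ψ Ψ C a H) {s h : ℝ} (hs : 1 < s)
    (hh : 0 < h) : ∃ C' : ℝ, 0 < C' ∧ ∀ (σ : ℝ) (k : Fin d) (l : ℕ) (n : ℤ), (l : ℝ) ≤ σ →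
      |(n : ℝ) / 2| ≤ σ → ∀ (j q : ℕ) (x : ℝ), |x| ^ j * ‖wilson1Deriv (Ψ k) l n q x‖ ≤
        C' * Real.exp (2 * s * (4 * Real.pi / h * σ) ^ (1 / s)) *
          (h ^ (j + q) * ((j.factorial : ℝ) ^ s * (q.factorial : ℝ) ^ s)) := by
  have hs0 : 0 < s := by linarith
  have hpi := Real.pi_pos
  obtain ⟨C₁, hC₁, h₁⟩ := hΨ.exists_gevrey_bound hs (half_pos hh)
  obtain ⟨C₂, hC₂, h₂⟩ := exists_pow_mul_exp_le hs (half_pos hh) hΨ.a_pos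
  refine ⟨2 * C₁ * (C₂ + 1), by positivity, fun σ k l n hl hn j q x => ?_⟩
  have hσ : 0 ≤ σ := (Nat.cast_nonneg l).trans hl
  set Λ := Real.exp (s * (4 * Real.pi / h * σ) ^ (1 / s)) with hΛ
  have hexp : ∀ t : ℝ, 0 ≤ t → t ≤ 2 * Real.pi * σ → ∀ r : ℕ,
      t ^ r ≤ Λ * ((h / 2) ^ r * (r.factorial : ℝ) ^ s) := by
    intro t ht htσ r
    refine (pow_le_exp_mul_gevrey hs0 (half_pos hh) ht r).trans ?_
    have h3 : t / (h / 2) ≤ 4 * Real.pi / h * σ := by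
      rw [div_le_iff₀ (by positivity)]
      calc t ≤ 2 * Real.pi * σ := htσ
        _ = _ := by field_simp; ring
    have h4 := factorial_rpow_pos s r
    rw [hΛ]
    gcongr
  have hΛ1 : 1 ≤ Λ := Real.one_le_exp (by positivity)
  set μ := wilsonCenter l n with hμ
  have hμσ : |μ| ≤ 2 * Real.pi * σ := by
    have := abs_wilsonCenter_le l n
    nlinarith [Real.pi_gt_three]
  have hm := pow_mul_norm_modulated_le (μ := μ) hs0.le (half_pos hh)
    (by positivity : 0 ≤ 2 * Real.pi * (l : ℝ)) hC₁.le (h₁ k)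
    (hexp (2 * Real.pi * l) (by positivity) (by gcongr)) q 0 0 (wilsonPhase l n) x
  simp only [pow_zero, one_mul, add_zero] at hm
  have hx : |x| ^ j ≤ 2 ^ j * (|x - μ| ^ j + |μ| ^ j) := by
    simpa using add_abs_pow_le (x - μ) μ j
  have hj := factorial_rpow_pos s j
  have hq := factorial_rpow_pos s q
  have hdecay : (|x - μ| ^ j + |μ| ^ j) * Real.exp (-a * |x - μ|) ≤
      (C₂ + 1) * Λ * ((h / 2) ^ j * (j.factorial : ℝ) ^ s) := by
    have h5 := h₂ j (x - μ)
    have h6 := hexp |μ| (abs_nonneg _) hμσ j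
    have h7 : Real.exp (-a * |x - μ|) ≤ 1 := Real.exp_le_one_iff.2 (by
      have := mul_nonneg hΨ.a_pos.le (abs_nonneg (x - μ)); linarith)
    have h8 : |μ| ^ j * Real.exp (-a * |x - μ|) ≤ |μ| ^ j := mul_le_of_le_one_right (by positivity) h7
    have h9 : C₂ * ((h / 2) ^ j * (j.factorial : ℝ) ^ s) ≤
        C₂ * Λ * ((h / 2) ^ j * (j.factorial : ℝ) ^ s) := by
      gcongr
      exact le_mul_of_one_le_right hC₂.le hΛ1
    linarith
  rw [wilson1Deriv, norm_mul, Complex.norm_real, Real.norm_of_nonneg (wilsonAmp_nonneg l)]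
  calc |x| ^ j * (wilsonAmp l * ‖modulated (2 * Real.pi * l) μ (Ψ k) q 0 (wilsonPhase l n) x‖)
      ≤ (2 ^ j * (|x - μ| ^ j + |μ| ^ j)) * (2 * (2 ^ q * (C₁ * Λ *
        ((h / 2) ^ q * (q.factorial : ℝ) ^ s) * Real.exp (-a * |x - μ|)))) := by
        gcongr
        · exact mul_nonneg (wilsonAmp_nonneg l) (norm_nonneg _)
        · exact wilsonAmp_le l
    _ = 2 * C₁ * 2 ^ j * 2 ^ q * Λ * ((h / 2) ^ q * (q.factorial : ℝ) ^ s) *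
        ((|x - μ| ^ j + |μ| ^ j) * Real.exp (-a * |x - μ|)) := by ring
    _ ≤ 2 * C₁ * 2 ^ j * 2 ^ q * Λ * ((h / 2) ^ q * (q.factorial : ℝ) ^ s) *
        ((C₂ + 1) * Λ * ((h / 2) ^ j * (j.factorial : ℝ) ^ s)) := by gcongr
    _ = 2 * C₁ * (C₂ + 1) * (Λ * Λ) *
        (((2 * (h / 2)) ^ j * (2 * (h / 2)) ^ q) *
          ((j.factorial : ℝ) ^ s * (q.factorial : ℝ) ^ s)) := by
        rw [mul_pow, mul_pow]; ring
    _ = _ := by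
        rw [hΛ, ← Real.exp_add, mul_div_cancel₀ h two_ne_zero, ← pow_add]
        congr 3
        ring

/-- The Gelfand-Shilov norms of the Wilson functions grow at most like a stretched exponential. -/
theorem exists_wilsonJet_bound (hΨ : IsWindowFamily ψ Ψ C a H) {s h : ℝ} (hs : 1 < s)
    (hh : 0 < h) : ∃ C' : ℝ, 0 < C' ∧ ∀ (p : Idx d) (α β : Fin d → ℕ) (x : E d),
      |monomial α x| * ‖wilsonJet Ψ p β x‖ ≤
        C' * Real.exp (d * (2 * s * (4 * Real.pi / h * idxSize p) ^ (1 / s))) *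
          gsDenom s h α β := by
  obtain ⟨C', hC', hb⟩ := hΨ.exists_wilson1Deriv_bound hs hh
  refine ⟨C' ^ d, by positivity, fun p α β x => ?_⟩
  rw [monomial, Finset.abs_prod, wilsonJet, norm_prod, ← Finset.prod_mul_distrib, gsDenom_eq_prod,
    Real.exp_nat_mul, ← mul_pow, ← Fin.prod_const, ← Finset.prod_mul_distrib]
  refine Finset.prod_le_prod (fun k _ => by positivity) fun k _ => ?_
  rw [abs_pow]
  exact hb _ k _ _ (fst_le_idxSize p k) (abs_snd_le_idxSize p k) _ _ _

end IsWindowFamily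

/-! ### Tensor integrals, special multi-indices and envelopes. -/

theorem integrable_tensor {d : ℕ} {𝕜 : Type*} [RCLike 𝕜] {g : Fin d → ℝ → 𝕜}
    (hg : ∀ k, Integrable (g k)) : Integrable fun x : E d => ∏ k, g k (x k) :=
  ((EuclideanSpace.volume_preserving_symm_measurableEquiv_toLp (Fin d)).integrable_comp_emb
    (MeasurableEquiv.measurableEmbedding _)).2 (Integrable.fintype_prod hg)

theorem integral_tensor {d : ℕ} {𝕜 : Type*} [RCLike 𝕜] (g : Fin d → ℝ → 𝕜) :
    ∫ x : E d, ∏ k, g k (x k) = ∏ k, ∫ t, g k t := by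
  rw [← integral_fintype_prod_volume_eq_prod]
  exact (EuclideanSpace.volume_preserving_symm_measurableEquiv_toLp (Fin d)).integral_comp
    (MeasurableEquiv.measurableEmbedding _) (fun y : Fin d → ℝ => ∏ k, g k (y k))

theorem mderiv_single {d : ℕ} (i : Fin d) (j : ℕ) (f : E d → ℂ) :
    mderiv (Pi.single i j) f = (pderiv i)^[j] f := by
  have key : ∀ L : List (Fin d),
      L.foldr (fun k g => (pderiv k)^[(Pi.single i j : Fin d → ℕ) k] g) f =
        (pderiv i)^[L.count i * j] f := by
    intro L
    induction L with
    | nil => simp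
    | cons k L ih =>
      rw [List.foldr_cons, ih]
      by_cases hk : k = i
      · subst hk
        rw [Pi.single_eq_same, List.count_cons_self, add_mul, one_mul, add_comm,
          Function.iterate_add_apply]
      · rw [Pi.single_eq_of_ne hk, List.count_cons_of_ne (by simpa using hk)]
        rfl
  rw [mderiv, key, List.count_eq_one_of_mem (List.nodup_finRange d) (List.mem_finRange i), one_mul]

theorem mderiv_zero {d : ℕ} (f : E d → ℂ) : mderiv (0 : Fin d → ℕ) f = f := by
  unfold mderiv
  induction List.finRange d with
  | nil => rfl
  | cons k L ih => rw [List.foldr_cons, ih]; rfl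

theorem monomial_single {d : ℕ} (i : Fin d) (j : ℕ) (x : E d) :
    monomial (Pi.single i j) x = x i ^ j := by
  unfold monomial
  rw [Finset.prod_eq_single i]
  · simp
  · intro k _ hk
    simp [hk]
  · simp

theorem monomial_zero {d : ℕ} (x : E d) : monomial 0 x = 1 := by simp [monomial]

theorem gsDenom_single_zero {d : ℕ} (s h : ℝ) (i : Fin d) (j : ℕ) :
    gsDenom s h (Pi.single i j) 0 = h ^ j * (j.factorial : ℝ) ^ s := by
  rw [gsDenom_eq_prod, Finset.prod_eq_single i]
  · simp
  · intro k _ hk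
    simp [hk]
  · simp

theorem gsDenom_zero_single {d : ℕ} (s h : ℝ) (i : Fin d) (j : ℕ) :
    gsDenom s h 0 (Pi.single i j) = h ^ j * (j.factorial : ℝ) ^ s := by
  rw [gsDenom_eq_prod, Finset.prod_eq_single i]
  · simp
  · intro k _ hk
    simp [hk]
  · simp

section Bounds

variable {d : ℕ} {s h N : ℝ} {f : E d → ℂ}

theorem abs_pow_mul_norm_le (hh : 0 < h) (hN : 0 ≤ N) (hf : gsENorm s h f ≤ ENNReal.ofReal N)
    (i : Fin d) (j : ℕ) (x : E d) :
    |x i| ^ j * ‖f x‖ ≤ N * (h ^ j * (j.factorial : ℝ) ^ s) := by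
  have := (gsENorm_le_iff hh hN f).1 hf (Pi.single i j) 0 x
  rwa [monomial_single, mderiv_zero, gsDenom_single_zero, abs_pow] at this

theorem norm_pderiv_iterate_le (hh : 0 < h) (hN : 0 ≤ N) (hf : gsENorm s h f ≤ ENNReal.ofReal N)
    (i : Fin d) (j : ℕ) (x : E d) :
    ‖(pderiv i)^[j] f x‖ ≤ N * (h ^ j * (j.factorial : ℝ) ^ s) := by
  have := (gsENorm_le_iff hh hN f).1 hf 0 (Pi.single i j) x
  rwa [monomial_zero, mderiv_single, gsDenom_zero_single, abs_one, one_mul] at this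

theorem norm_le_of_gsENorm_le (hh : 0 < h) (hN : 0 ≤ N) (hf : gsENorm s h f ≤ ENNReal.ofReal N)
    (x : E d) : ‖f x‖ ≤ N := by
  have := (gsENorm_le_iff hh hN f).1 hf 0 0 x
  rw [monomial_zero, mderiv_zero, abs_one, one_mul] at this
  simpa [gsDenom] using this

end Bounds

/-- A product of exponentially decaying functions centred at `μ`. -/
def envelope {d : ℕ} (a : ℝ) (μ : Fin d → ℝ) (x : E d) : ℝ := ∏ k, Real.exp (-a * |x k - μ k|)

theorem envelope_nonneg {d : ℕ} (a : ℝ) (μ : Fin d → ℝ) (x : E d) : 0 ≤ envelope a μ x :=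
  Finset.prod_nonneg fun _ _ => (Real.exp_pos _).le

theorem integrable_envelope {d : ℕ} {a : ℝ} (ha : 0 < a) (μ : Fin d → ℝ) :
    Integrable (envelope a μ) :=
  integrable_tensor (g := fun k t => Real.exp (-a * |t - μ k|)) fun k =>
    (integrable_exp_neg_abs ha).comp_sub_right (μ k)

theorem integral_envelope {d : ℕ} (a : ℝ) (μ : Fin d → ℝ) :
    ∫ x, envelope a μ x = (∫ t : ℝ, Real.exp (-a * |t|)) ^ d := by
  unfold envelope
  rw [integral_tensor fun k t => Real.exp (-a * |t - μ k|)]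
  rw [← Fin.prod_const]
  exact Finset.prod_congr rfl fun k _ =>
    integral_sub_right_eq_self (fun t : ℝ => Real.exp (-a * |t|)) (μ k)

theorem pairing_wilson {d : ℕ} (f : E d → ℂ) (ψ : Fin d → ℝ → ℝ) (p : Idx d) :
    pairing f (wilson ψ p) = ∫ x, f x * wilson ψ p x := by
  unfold pairing wilson
  simp only [map_prod, Complex.conj_ofReal]

namespace IsWindowFamily

variable {d : ℕ} {ψ : Fin d → ℝ → ℝ} {Ψ : Fin d → ℕ → ℝ → ℂ} {C a H : ℝ}

theorem continuous (hΨ : IsWindowFamily ψ Ψ C a H) (k : Fin d) (m : ℕ) : Continuous (Ψ k m) :=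
  continuous_iff_continuousAt.2 fun x => (hΨ.hasDerivAt k m x).continuousAt

theorem norm_wilson1_le (hΨ : IsWindowFamily ψ Ψ C a H) (k : Fin d) (l : ℕ) (n : ℤ) (x : ℝ) :
    ‖(wilson1 (ψ k) l n x : ℂ)‖ ≤ (2 * C + 1) * Real.exp (-a * |x - wilsonCenter l n|) := by
  have h1 := hΨ.bound k 0 (x - wilsonCenter l n)
  have hC := hΨ.C_pos
  simp only [hΨ.zero, pow_zero, Nat.factorial_zero, Nat.cast_one, mul_one, Complex.norm_real,
    Real.norm_eq_abs] at h1
  rw [wilson1_eq, Complex.norm_real, Real.norm_eq_abs, abs_mul, abs_mul,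
    abs_of_nonneg (wilsonAmp_nonneg l)]
  calc _ ≤ 2 * 1 * (C * Real.exp (-a * |x - wilsonCenter l n|)) := by
        gcongr
        · exact wilsonAmp_le l
        · exact Real.abs_cos_le_one _
    _ ≤ _ := by
        have := Real.exp_pos (-a * |x - wilsonCenter l n|)
        nlinarith

theorem norm_prod_wilson1_le (hΨ : IsWindowFamily ψ Ψ C a H) (p : Idx d) (S : Finset (Fin d))
    (x : E d) : ‖∏ k ∈ S, (wilson1 (ψ k) (p.1 k) (p.2 k) (x k) : ℂ)‖ ≤
      (2 * C + 1) ^ d * ∏ k ∈ S, Real.exp (-a * |x k - wilsonCenter (p.1 k) (p.2 k)|) := by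
  have hC := hΨ.C_pos
  rw [norm_prod]
  refine (Finset.prod_le_prod (fun k _ => norm_nonneg _)
    fun k _ => hΨ.norm_wilson1_le k _ _ _).trans ?_
  rw [Finset.prod_mul_distrib, Finset.prod_const]
  have hcard : S.card ≤ d := by simpa using Finset.card_le_univ S
  -- The constant `2 * C + 1`, rather than `2 * C`, is at least 1, so the exponent can be raised
  -- from `S.card` to `d`.
  refine mul_le_mul_of_nonneg_right (pow_le_pow_right₀ (by linarith) hcard)
    (Finset.prod_nonneg fun k _ => (Real.exp_pos _).le)

theorem norm_wilson_le (hΨ : IsWindowFamily ψ Ψ C a H) (p : Idx d) (x : E d) :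
    ‖wilson ψ p x‖ ≤
      (2 * C + 1) ^ d * envelope a (fun k => wilsonCenter (p.1 k) (p.2 k)) x :=
  hΨ.norm_prod_wilson1_le p Finset.univ x

theorem continuous_wilson1 (hΨ : IsWindowFamily ψ Ψ C a H) (k : Fin d) (l : ℕ) (n : ℤ) :
    Continuous fun x => (wilson1 (ψ k) l n x : ℂ) := by
  have : (fun x => (wilson1 (ψ k) l n x : ℂ)) = wilson1Deriv (Ψ k) l n 0 :=
    funext fun x => (hΨ.wilson1Deriv_zero k l n x).symm
  rw [this]
  exact continuous_iff_continuousAt.2 fun x => (hΨ.hasDerivAt_wilson1Deriv k l n 0 x).continuousAt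

theorem continuous_wilson (hΨ : IsWindowFamily ψ Ψ C a H) (p : Idx d) :
    Continuous (wilson ψ p) :=
  continuous_finsetProd _ fun k _ => (hΨ.continuous_wilson1 k _ _).comp (by fun_prop)

theorem integrable_wilson (hΨ : IsWindowFamily ψ Ψ C a H) (p : Idx d) :
    Integrable (wilson ψ p) :=
  ((integrable_envelope hΨ.a_pos _).const_mul _).mono'
    (hΨ.continuous_wilson p).aestronglyMeasurable
    (Filter.Eventually.of_forall fun x => hΨ.norm_wilson_le p x)

/-! ### Decay of the coefficients -/

/-- From `μ = x - (x - μ)`, a power of the centre splits into a power of `x i`, controlled by the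
norm of `f`, and a power of `x i - μ i`, controlled by the decay of the window. -/
theorem exists_pow_center_mul_norm_pairing_le (hΨ : IsWindowFamily ψ Ψ C a H) {s h : ℝ}
    (hs : 1 < s) (hh : 0 < h) :
    ∃ A : ℝ, 0 < A ∧ ∀ (f : E d → ℂ) (N : ℝ), 0 ≤ N → gsENorm s h f ≤ ENNReal.ofReal N →
      ∀ (p : Idx d) (i : Fin d) (q : ℕ), |(p.2 i : ℝ) / 2| ^ q * ‖pairing f (wilson ψ p)‖ ≤
        A * N * ((2 * h) ^ q * (q.factorial : ℝ) ^ s) := by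
  have ha := hΨ.a_pos
  have hC := hΨ.C_pos
  obtain ⟨C₂, hC₂, h₂⟩ := exists_pow_mul_exp_le hs hh (half_pos ha)
  have hI : 0 < ∫ t : ℝ, Real.exp (-(a / 2) * |t|) :=
    integral_exp_pos (integrable_exp_neg_abs (half_pos ha))
  refine ⟨(1 + C₂) * (2 * C + 1) ^ d * (∫ t : ℝ, Real.exp (-(a / 2) * |t|)) ^ d,
    by positivity, fun f N hN hf p i q => ?_⟩
  set μ : Fin d → ℝ := fun k => wilsonCenter (p.1 k) (p.2 k) with hμ
  have hq := factorial_rpow_pos s q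
  -- Half of the decay is spent on `|x i - μ i| ^ q`; the other half keeps the integrand integrable.
  have hsplit : ∀ x, envelope a μ x ≤
      Real.exp (-(a / 2) * |x i - μ i|) * envelope (a / 2) μ x := by
    intro x
    have h1 : envelope a μ x = envelope (a / 2) μ x * envelope (a / 2) μ x := by
      unfold envelope
      rw [← Finset.prod_mul_distrib]
      refine Finset.prod_congr rfl fun k _ => ?_
      rw [← Real.exp_add]; congr 1; ring
    rw [h1]
    refine mul_le_mul_of_nonneg_right ?_ (envelope_nonneg _ _ _)
    rw [envelope, ← Finset.mul_prod_erase _ _ (Finset.mem_univ i)]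
    refine mul_le_of_le_one_right (Real.exp_pos _).le
      (Finset.prod_le_one (fun k _ => (Real.exp_pos _).le) fun k _ => Real.exp_le_one_iff.2 ?_)
    have := mul_nonneg ha.le (abs_nonneg (x k - μ k))
    linarith
  have hpt : ∀ x, ‖f x * wilson ψ p x‖ * |μ i| ^ q ≤
      (1 + C₂) * (2 * C + 1) ^ d * N * ((2 * h) ^ q * (q.factorial : ℝ) ^ s) *
        envelope (a / 2) μ x := by
    intro x
    have h1 : |μ i| ^ q ≤ 2 ^ q * (|x i| ^ q + |x i - μ i| ^ q) := by
      have := add_abs_pow_le (x i) (-(x i - μ i)) q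
      rwa [abs_neg, show x i + -(x i - μ i) = μ i by ring] at this
    have h3 := abs_pow_mul_norm_le hh hN hf i q x
    have h4 := norm_le_of_gsENorm_le hh hN hf x
    have h5 := h₂ q (x i - μ i)
    have h6 : Real.exp (-(a / 2) * |x i - μ i|) ≤ 1 := Real.exp_le_one_iff.2 (by
      have := mul_nonneg ha.le (abs_nonneg (x i - μ i)); linarith)
    have h7 : (|x i| ^ q + |x i - μ i| ^ q) * (‖f x‖ * Real.exp (-(a / 2) * |x i - μ i|)) ≤
        (1 + C₂) * N * (h ^ q * (q.factorial : ℝ) ^ s) := by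
      calc _ = |x i| ^ q * ‖f x‖ * Real.exp (-(a / 2) * |x i - μ i|) +
            ‖f x‖ * (|x i - μ i| ^ q * Real.exp (-(a / 2) * |x i - μ i|)) := by ring
        _ ≤ N * (h ^ q * (q.factorial : ℝ) ^ s) * 1 +
            N * (C₂ * (h ^ q * (q.factorial : ℝ) ^ s)) := by gcongr
        _ = _ := by ring
    have h8 := envelope_nonneg (a / 2) μ x
    rw [norm_mul]
    calc ‖f x‖ * ‖wilson ψ p x‖ * |μ i| ^ q ≤ ‖f x‖ * ((2 * C + 1) ^ d *
          (Real.exp (-(a / 2) * |x i - μ i|) * envelope (a / 2) μ x)) *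
          (2 ^ q * (|x i| ^ q + |x i - μ i| ^ q)) := by
          gcongr
          exact (hΨ.norm_wilson_le p x).trans (by gcongr; exact hsplit x)
      _ = (2 * C + 1) ^ d * 2 ^ q * envelope (a / 2) μ x *
          ((|x i| ^ q + |x i - μ i| ^ q) * (‖f x‖ * Real.exp (-(a / 2) * |x i - μ i|))) := by ring
      _ ≤ (2 * C + 1) ^ d * 2 ^ q * envelope (a / 2) μ x *
          ((1 + C₂) * N * (h ^ q * (q.factorial : ℝ) ^ s)) := by gcongr
      _ = _ := by rw [mul_pow]; ring
  calc |(p.2 i : ℝ) / 2| ^ q * ‖pairing f (wilson ψ p)‖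
      ≤ |μ i| ^ q * ‖pairing f (wilson ψ p)‖ := by
        exact mul_le_mul_of_nonneg_right
          (pow_le_pow_left₀ (abs_nonneg _) (abs_half_le_abs_wilsonCenter _ _) q) (norm_nonneg _)
    _ = ‖∫ x, f x * wilson ψ p x * ((|μ i| ^ q : ℝ) : ℂ)‖ := by
        rw [integral_mul_const, norm_mul, Complex.norm_real, Real.norm_of_nonneg (by positivity),
          pairing_wilson, mul_comm]
    _ ≤ ∫ x, (1 + C₂) * (2 * C + 1) ^ d * N * ((2 * h) ^ q * (q.factorial : ℝ) ^ s) *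
        envelope (a / 2) μ x := by
        refine norm_integral_le_of_norm_le ((integrable_envelope (half_pos ha) μ).const_mul _)
          (Filter.Eventually.of_forall fun x => ?_)
        rw [norm_mul, Complex.norm_real, Real.norm_of_nonneg (by positivity)]
        exact hpt x
    _ = _ := by rw [integral_const_mul, integral_envelope]; ring

/-- The integrand obtained from `f · ψ_{l,n}` by differentiating `f` and the window in direction
`e_i`, with the remaining oscillating factor having phase `θ`. -/
def oscIntegrand (ψ : Fin d → ℝ → ℝ) (Ψ : Fin d → ℕ → ℝ → ℂ) (f : E d → ℂ) (p : Idx d) (i : Fin d)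
    (j m : ℕ) (θ : ℝ) (x : E d) : ℂ :=
  ((pderiv i)^[j] f x * Ψ i m (x i - wilsonCenter (p.1 i) (p.2 i))) *
    ((Real.cos (2 * Real.pi * p.1 i * x i + θ) : ℂ) *
      ∏ k ∈ Finset.univ.erase i, (wilson1 (ψ k) (p.1 k) (p.2 k) (x k) : ℂ))

theorem exists_norm_oscIntegrand_le (hΨ : IsWindowFamily ψ Ψ C a H) {s h : ℝ} (hs : 1 < s)
    (hh : 0 < h) :
    ∃ A : ℝ, 0 < A ∧ ∀ (f : E d → ℂ) (N : ℝ), 0 ≤ N → gsENorm s h f ≤ ENNReal.ofReal N →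
      ∀ (p : Idx d) (i : Fin d) (j m : ℕ) (θ : ℝ) (x : E d),
        ‖oscIntegrand ψ Ψ f p i j m θ x‖ ≤ A * N * (h ^ (j + m) * ((j + m).factorial : ℝ) ^ s) *
          envelope a (fun k => wilsonCenter (p.1 k) (p.2 k)) x := by
  have hC := hΨ.C_pos
  obtain ⟨C₁, hC₁, h₁⟩ := hΨ.exists_gevrey_bound hs hh
  refine ⟨C₁ * (2 * C + 1) ^ d, by positivity, fun f N hN hf p i j m θ x => ?_⟩
  have hR := hΨ.norm_prod_wilson1_le p (Finset.univ.erase i) x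
  set μ : Fin d → ℝ := fun k => wilsonCenter (p.1 k) (p.2 k) with hμ
  have henv : envelope a μ x = Real.exp (-a * |x i - μ i|) *
      ∏ k ∈ Finset.univ.erase i, Real.exp (-a * |x k - μ k|) :=
    (Finset.mul_prod_erase _ _ (Finset.mem_univ i)).symm
  have hP : 0 ≤ ∏ k ∈ Finset.univ.erase i, Real.exp (-a * |x k - μ k|) :=
    Finset.prod_nonneg fun _ _ => (Real.exp_pos _).le
  have hjf := factorial_rpow_pos s j
  have hmf := factorial_rpow_pos s m
  rw [oscIntegrand, norm_mul, norm_mul, norm_mul, Complex.norm_real, Real.norm_eq_abs]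
  calc _ ≤ (N * (h ^ j * (j.factorial : ℝ) ^ s) *
        (C₁ * (h ^ m * (m.factorial : ℝ) ^ s) * Real.exp (-a * |x i - μ i|))) *
        (1 * ((2 * C + 1) ^ d * ∏ k ∈ Finset.univ.erase i, Real.exp (-a * |x k - μ k|))) := by
        gcongr
        · exact norm_pderiv_iterate_le hh hN hf i j x
        · exact h₁ i m _
        · exact Real.abs_cos_le_one _
    _ = C₁ * (2 * C + 1) ^ d * N * (h ^ (j + m) *
        ((j.factorial : ℝ) ^ s * (m.factorial : ℝ) ^ s)) * envelope a μ x := by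
        rw [henv, pow_add]; ring
    _ ≤ _ := by
        have := envelope_nonneg a μ x
        gcongr
        exact factorial_rpow_mul_le (by linarith) j m

theorem continuous_oscIntegrand (hΨ : IsWindowFamily ψ Ψ C a H) {f : E d → ℂ}
    (hf : ContDiff ℝ ∞ f) (p : Idx d) (i : Fin d) (j m : ℕ) (θ : ℝ) :
    Continuous (oscIntegrand ψ Ψ f p i j m θ) := by
  unfold oscIntegrand
  refine ((contDiff_pderiv_iterate i j hf).continuous.mul
    ((hΨ.continuous i m).comp (by fun_prop))).mul (Continuous.mul (by fun_prop) ?_)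
  exact continuous_finsetProd _ fun k _ => (hΨ.continuous_wilson1 k _ _).comp (by fun_prop)

theorem integrable_oscIntegrand (hΨ : IsWindowFamily ψ Ψ C a H) {s h N : ℝ} (hs : 1 < s)
    (hh : 0 < h) (hN : 0 ≤ N) {f : E d → ℂ} (hf : ContDiff ℝ ∞ f)
    (hfN : gsENorm s h f ≤ ENNReal.ofReal N) (p : Idx d) (i : Fin d) (j m : ℕ) (θ : ℝ) :
    Integrable (oscIntegrand ψ Ψ f p i j m θ) := by
  obtain ⟨A, -, hA⟩ := hΨ.exists_norm_oscIntegrand_le hs hh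
  exact ((integrable_envelope hΨ.a_pos _).const_mul _).mono'
    (hΨ.continuous_oscIntegrand hf p i j m θ).aestronglyMeasurable
    (Filter.Eventually.of_forall fun x => hA f N hN hfN p i j m θ x)

/-- Integration by parts in direction `e_i`. -/
theorem freq_mul_integral_oscIntegrand (hΨ : IsWindowFamily ψ Ψ C a H) {s h N : ℝ} (hs : 1 < s)
    (hh : 0 < h) (hN : 0 ≤ N) {f : E d → ℂ} (hf : ContDiff ℝ ∞ f)
    (hfN : gsENorm s h f ≤ ENNReal.ofReal N) (p : Idx d) (i : Fin d) (j m : ℕ) (θ : ℝ) :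
    ((2 * Real.pi * p.1 i : ℝ) : ℂ) * ∫ x, oscIntegrand ψ Ψ f p i j m θ x =
      -(∫ x, oscIntegrand ψ Ψ f p i (j + 1) m (θ - Real.pi / 2) x) -
        ∫ x, oscIntegrand ψ Ψ f p i j (m + 1) (θ - Real.pi / 2) x := by
  have hint := hΨ.integrable_oscIntegrand hs hh hN hf hfN p i
  set κ : ℝ := 2 * Real.pi * p.1 i with hκ
  set μ := wilsonCenter (p.1 i) (p.2 i) with hμ
  set R : E d → ℂ := fun x =>
    ∏ k ∈ Finset.univ.erase i, (wilson1 (ψ k) (p.1 k) (p.2 k) (x k) : ℂ) with hR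
  set v : E d := EuclideanSpace.single i 1 with hv
  have hcoord : ∀ (x : E d) (t : ℝ), (x + t • v) i = x i + t := by
    intro x t; simp [hv]
  have hRv : ∀ (x : E d) (t : ℝ), R (x + t • v) = R x := by
    intro x t
    refine Finset.prod_congr rfl fun k hk => ?_
    have : (x + t • v) k = x k := by simp [hv, (Finset.mem_erase.1 hk).1]
    rw [this]
  -- `κ cos (κ t + θ)` is the derivative of `cos (κ t + θ - π / 2)`. The other tensor factors do not
  -- depend on the `i`-th coordinate, so the derivative moves onto `f` and the `i`-th window only.
  have key := integral_bilinear_hasLineDerivAt_right_eq_neg_left_of_integrable (μ := volume)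
    (B := ContinuousLinearMap.mul ℝ ℂ) (v := v)
    (f := fun x => (pderiv i)^[j] f x * Ψ i m (x i - μ))
    (f' := fun x => (pderiv i)^[j + 1] f x * Ψ i m (x i - μ) +
      (pderiv i)^[j] f x * Ψ i (m + 1) (x i - μ))
    (g := fun x => (Real.cos (κ * x i + (θ - Real.pi / 2)) : ℂ) * R x)
    (g' := fun x => κ * ((Real.cos (κ * x i + θ) : ℂ) * R x)) ?_ ?_ ?_ ?_ ?_
  · simp only [ContinuousLinearMap.mul_apply'] at key
    rw [← integral_const_mul, ← neg_add', ← integral_add (hint (j + 1) m _) (hint j (m + 1) _)]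
    convert! key using 2
    · funext x; rw [oscIntegrand]; ring
    · congr 1; funext x; rw [oscIntegrand, oscIntegrand]; ring
  · simp only [ContinuousLinearMap.mul_apply']
    convert! (hint (j + 1) m (θ - Real.pi / 2)).add (hint j (m + 1) (θ - Real.pi / 2)) using 1
    funext x; rw [Pi.add_apply, oscIntegrand, oscIntegrand]; ring
  · simp only [ContinuousLinearMap.mul_apply']
    convert! (hint j m θ).const_mul (κ : ℂ) using 1
    funext x; rw [oscIntegrand]; ring
  · simp only [ContinuousLinearMap.mul_apply']
    exact hint j m (θ - Real.pi / 2)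
  · intro x _
    have h1 : HasLineDerivAt ℝ ((pderiv i)^[j] f) ((pderiv i)^[j + 1] f x) x v := by
      rw [Function.iterate_succ_apply']
      exact (((contDiff_pderiv_iterate i j hf).differentiable (by simp)) x).hasFDerivAt.hasLineDerivAt v
    have h2 : HasDerivAt (fun t : ℝ => Ψ i m ((x + t • v) i - μ)) (Ψ i (m + 1) (x i - μ)) 0 := by
      simp only [hcoord]
      have h3 : HasDerivAt (fun t : ℝ => x i + t - μ) 1 0 := by
        simpa using ((hasDerivAt_id (0 : ℝ)).const_add (x i)).sub_const μ
      have h4 := hΨ.hasDerivAt i m (x i + 0 - μ)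
      simpa [Function.comp_def] using h4.scomp (0 : ℝ) h3
    have h5 := HasDerivAt.mul (show HasDerivAt (fun t : ℝ => (pderiv i)^[j] f (x + t • v)) _ 0 from h1) h2
    unfold HasLineDerivAt
    convert! h5 using 1
    simp
  · intro x _
    have h1 : HasDerivAt (fun t : ℝ => (Real.cos (κ * ((x + t • v) i) + (θ - Real.pi / 2)) : ℂ))
        (κ * (Real.cos (κ * x i + θ) : ℂ)) 0 := by
      simp only [hcoord]
      have h2 := hasDerivAt_cos_phase κ (κ * x i + (θ - Real.pi / 2)) 0
      convert! h2 using 1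
      · funext t; congr 2; ring
      · congr 3; ring
    have h3 := h1.mul_const (R x)
    unfold HasLineDerivAt
    simp only [hRv]
    convert! h3 using 1
    ring

/-- Every power of the frequency is traded for an integration by parts. This doubles the number of
terms and raises `j + m` by one, so after `q` rounds there are `2 ^ q` terms of order `q`, whence
the radius `2 * h`. -/
theorem exists_pow_freq_mul_norm_pairing_le (hΨ : IsWindowFamily ψ Ψ C a H) {s h : ℝ}
    (hs : 1 < s) (hh : 0 < h) :
    ∃ A : ℝ, 0 < A ∧ ∀ (f : E d → ℂ) (N : ℝ), ContDiff ℝ ∞ f → 0 ≤ N →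
      gsENorm s h f ≤ ENNReal.ofReal N →
      ∀ (p : Idx d) (i : Fin d) (q : ℕ), (p.1 i : ℝ) ^ q * ‖pairing f (wilson ψ p)‖ ≤
        A * N * ((2 * h) ^ q * (q.factorial : ℝ) ^ s) := by
  have ha := hΨ.a_pos
  obtain ⟨A, hA, hb⟩ := hΨ.exists_norm_oscIntegrand_le hs hh
  have hI : 0 < ∫ t : ℝ, Real.exp (-a * |t|) := integral_exp_pos (integrable_exp_neg_abs ha)
  refine ⟨2 * (A * (∫ t : ℝ, Real.exp (-a * |t|)) ^ d), by positivity,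
    fun f N hfc hN hf p i q => ?_⟩
  set κ : ℝ := 2 * Real.pi * p.1 i with hκ
  have hκ0 : 0 ≤ κ := by have := Real.pi_pos; positivity
  set B := A * (∫ t : ℝ, Real.exp (-a * |t|)) ^ d * N with hB
  have main : ∀ (q j m : ℕ) (θ : ℝ), κ ^ q * ‖∫ x, oscIntegrand ψ Ψ f p i j m θ x‖ ≤
      2 ^ q * (B * (h ^ (j + m + q) * ((j + m + q).factorial : ℝ) ^ s)) := by
    intro q
    induction q with
    | zero =>
      intro j m θ
      rw [pow_zero, pow_zero, one_mul, one_mul]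
      refine (norm_integral_le_of_norm_le ((integrable_envelope ha _).const_mul _)
        (Filter.Eventually.of_forall fun x => hb f N hN hf p i j m θ x)).trans_eq ?_
      rw [integral_const_mul, integral_envelope, add_zero]
      ring
    | succ q ih =>
      intro j m θ
      have h1 : κ * ‖∫ x, oscIntegrand ψ Ψ f p i j m θ x‖ ≤
          ‖∫ x, oscIntegrand ψ Ψ f p i (j + 1) m (θ - Real.pi / 2) x‖ +
          ‖∫ x, oscIntegrand ψ Ψ f p i j (m + 1) (θ - Real.pi / 2) x‖ := by
        have h2 := hΨ.freq_mul_integral_oscIntegrand hs hh hN hfc hf p i j m θ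
        have h3 := congrArg norm h2
        rw [norm_mul, Complex.norm_real, Real.norm_of_nonneg hκ0] at h3
        rw [h3, ← norm_neg (∫ x, oscIntegrand ψ Ψ f p i (j + 1) m (θ - Real.pi / 2) x)]
        exact norm_sub_le _ _
      have h4 := ih (j + 1) m (θ - Real.pi / 2)
      have h5 := ih j (m + 1) (θ - Real.pi / 2)
      rw [show j + 1 + m + q = j + m + (q + 1) by ring] at h4
      rw [show j + (m + 1) + q = j + m + (q + 1) by ring] at h5
      calc _ = κ ^ q * (κ * ‖∫ x, oscIntegrand ψ Ψ f p i j m θ x‖) := by ring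
        _ ≤ κ ^ q * (‖∫ x, oscIntegrand ψ Ψ f p i (j + 1) m (θ - Real.pi / 2) x‖ +
          ‖∫ x, oscIntegrand ψ Ψ f p i j (m + 1) (θ - Real.pi / 2) x‖) := by gcongr
        _ ≤ 2 ^ q * (B * (h ^ (j + m + (q + 1)) * ((j + m + (q + 1)).factorial : ℝ) ^ s)) +
            2 ^ q * (B * (h ^ (j + m + (q + 1)) * ((j + m + (q + 1)).factorial : ℝ) ^ s)) := by
          rw [mul_add]; exact add_le_add h4 h5
        _ = _ := by ring
  have hpair : pairing f (wilson ψ p) = wilsonAmp (p.1 i) *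
      ∫ x, oscIntegrand ψ Ψ f p i 0 0 (wilsonPhase (p.1 i) (p.2 i)) x := by
    rw [pairing_wilson, ← integral_const_mul]
    congr 1
    funext x
    rw [oscIntegrand, wilson, ← Finset.mul_prod_erase _ _ (Finset.mem_univ i), wilson1_eq, hΨ.zero]
    push_cast
    simp only [Function.iterate_zero, id]
    ring
  have h6 := main q 0 0 (wilsonPhase (p.1 i) (p.2 i))
  rw [hpair, norm_mul, Complex.norm_real, Real.norm_of_nonneg (wilsonAmp_nonneg _)]
  have h7 : (p.1 i : ℝ) ≤ κ := by
    have : (0 : ℝ) ≤ p.1 i := Nat.cast_nonneg _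
    nlinarith [Real.pi_gt_three]
  calc _ ≤ κ ^ q * (2 * ‖∫ x, oscIntegrand ψ Ψ f p i 0 0 (wilsonPhase (p.1 i) (p.2 i)) x‖) := by
        gcongr
        · exact mul_nonneg (wilsonAmp_nonneg _) (norm_nonneg _)
        · exact wilsonAmp_le _
    _ = 2 * (κ ^ q * ‖∫ x, oscIntegrand ψ Ψ f p i 0 0 (wilsonPhase (p.1 i) (p.2 i)) x‖) := by ring
    _ ≤ 2 * (2 ^ q * (B * (h ^ (0 + 0 + q) * ((0 + 0 + q).factorial : ℝ) ^ s))) := by gcongr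
    _ = _ := by
      rw [zero_add, zero_add, mul_pow, hB]; ring

end IsWindowFamily

theorem norm_le_sum_abs {d : ℕ} (x : E d) : ‖x‖ ≤ ∑ i, |x i| := by
  have h := (EuclideanSpace.basisFun (Fin d) ℝ).sum_repr x
  calc ‖x‖ = ‖∑ i, (EuclideanSpace.basisFun (Fin d) ℝ).repr x i •
        EuclideanSpace.basisFun (Fin d) ℝ i‖ := by rw [h]
    _ ≤ ∑ i, ‖(EuclideanSpace.basisFun (Fin d) ℝ).repr x i •
        EuclideanSpace.basisFun (Fin d) ℝ i‖ := norm_sum_le _ _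
    _ = _ := by simp [norm_smul]

theorem idxSize_le_sum {d : ℕ} (p : Idx d) :
    idxSize p ≤ ∑ i, (|(p.2 i : ℝ) / 2| + (p.1 i : ℝ)) := by
  rw [Finset.sum_add_distrib]
  refine add_le_add ((norm_le_sum_abs _).trans_eq ?_) ((norm_le_sum_abs _).trans_eq ?_)
  · rfl
  · simp

/-- Stretched exponential decay of the Wilson coefficients of a function in a step. -/
theorem IsWindowFamily.exists_norm_pairing_le {d : ℕ} {ψ : Fin d → ℝ → ℝ}
    {Ψ : Fin d → ℕ → ℝ → ℂ} {C a H : ℝ} (hΨ : IsWindowFamily ψ Ψ C a H) {s h : ℝ}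
    (hs : 1 < s) (hh : 0 < h) :
    ∃ A : ℝ, 0 < A ∧ ∀ (f : E d → ℂ) (N : ℝ), ContDiff ℝ ∞ f → 0 ≤ N →
      gsENorm s h f ≤ ENNReal.ofReal N → ∀ p : Idx d, ‖pairing f (wilson ψ p)‖ ≤
        A * N * Real.exp (-(s / 2 * (idxSize p / (4 * d * h)) ^ (1 / s))) := by
  have ha := hΨ.a_pos
  have hC := hΨ.C_pos
  have hs0 : 0 < s := by linarith
  obtain ⟨A₁, hA₁, h₁⟩ := hΨ.exists_pow_center_mul_norm_pairing_le hs hh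
  obtain ⟨A₂, hA₂, h₂⟩ := hΨ.exists_pow_freq_mul_norm_pairing_le hs hh
  have hI : 0 < ∫ t : ℝ, Real.exp (-a * |t|) := integral_exp_pos (integrable_exp_neg_abs ha)
  -- For `d = 0` the quotient by `4 * d * h` is 0 by convention and the exponential is 1, so a plain
  -- bound suffices.
  rcases Nat.eq_zero_or_pos d with rfl | hd
  · refine ⟨(2 * C + 1) ^ 0 * (∫ t : ℝ, Real.exp (-a * |t|)) ^ 0, by positivity,
      fun f N _ hN hf p => ?_⟩
    have h3 : pairing f (wilson ψ p) = ∫ x, f x * wilson ψ p x := pairing_wilson f ψ p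
    have h4 := norm_integral_le_of_norm_le (f := fun x => f x * wilson ψ p x)
      ((integrable_envelope (d := 0) ha (fun k => wilsonCenter (p.1 k) (p.2 k))).const_mul
        (N * (2 * C + 1) ^ 0)) (Filter.Eventually.of_forall fun x => by
          rw [norm_mul, mul_assoc]
          exact mul_le_mul (norm_le_of_gsENorm_le hh hN hf x) (hΨ.norm_wilson_le p x)
            (norm_nonneg _) hN)
    rw [integral_const_mul, integral_envelope] at h4
    rw [h3]
    refine h4.trans_eq ?_
    have h5 : (0 : ℝ) ^ (1 / s) = 0 := Real.zero_rpow (by positivity)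
    simp [hs0.ne']
  · refine ⟨2 ^ s * (A₁ + A₂), by positivity, fun f N hfc hN hf p => ?_⟩
    have hd' : (0 : ℝ) < d := Nat.cast_pos.2 hd
    have hσ := idxSize_nonneg p
    -- Pigeonhole: some coordinate carries a `1 / d` share of the index size, and then its centre or
    -- its frequency part is at least `idxSize p / (2 * d)`. With radius `2 * h` this gives the
    -- denominator `4 * d * h`.
    obtain ⟨i, -, hi⟩ : ∃ i ∈ (Finset.univ : Finset (Fin d)),
        idxSize p / d ≤ |(p.2 i : ℝ) / 2| + (p.1 i : ℝ) := by
      refine Finset.exists_le_of_sum_le (s := Finset.univ) ⟨⟨0, hd⟩, Finset.mem_univ _⟩ ?_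
      rw [Finset.sum_const, Finset.card_univ, Fintype.card_fin, nsmul_eq_mul,
        mul_div_cancel₀ _ hd'.ne']
      exact idxSize_le_sum p
    have hfin : ∀ t : ℝ, idxSize p / (2 * d) ≤ t → ∀ A', 0 ≤ A' → A' ≤ A₁ + A₂ →
        (∀ q : ℕ, t ^ q * ‖pairing f (wilson ψ p)‖ ≤
          A' * N * ((2 * h) ^ q * (q.factorial : ℝ) ^ s)) →
        ‖pairing f (wilson ψ p)‖ ≤ 2 ^ s * (A₁ + A₂) * N *
          Real.exp (-(s / 2 * (idxSize p / (4 * d * h)) ^ (1 / s))) := by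
      intro t ht A' hA0 hA' hq
      have ht0 : 0 ≤ t := le_trans (by positivity) ht
      refine (le_exp_of_forall_pow_mul_le hs0 (by positivity) ht0 (by positivity)
        (norm_nonneg _) hq).trans ?_
      have h6 : idxSize p / (4 * d * h) ≤ t / (2 * h) := by
        calc idxSize p / (4 * d * h) = idxSize p / (2 * d) / (2 * h) := by
              rw [div_div]; congr 1; ring
          _ ≤ _ := by gcongr
      rw [← mul_assoc]
      gcongr
    rcases le_total (idxSize p / (2 * d)) |(p.2 i : ℝ) / 2| with h7 | h7
    · exact hfin _ h7 A₁ hA₁.le (by linarith) (h₁ f N hN hf p i)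
    · refine hfin (p.1 i : ℝ) ?_ A₂ hA₂.le (by linarith) (h₂ f N hfc hN hf p i)
      have : idxSize p / d = 2 * (idxSize p / (2 * d)) := by field_simp
      linarith

/-! ### Orthonormality. -/

theorem IsWilsonGenerator.memLp {ψ : ℝ → ℝ} (hψ : IsWilsonGenerator ψ) (l : ℕ) (n : ℤ) :
    MemLp (fun x => (wilson1 ψ l n x : ℂ)) 2 := by
  obtain ⟨B, hB⟩ := hψ.orthonormal_basis
  exact (memLp_congr_ae (hB l n)).1 (Lp.memLp (B (l, n)))

theorem IsWilsonGenerator.integral_mul {ψ : ℝ → ℝ} (hψ : IsWilsonGenerator ψ) (l l' : ℕ)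
    (n n' : ℤ) : ∫ x, (wilson1 ψ l n x : ℂ) * (wilson1 ψ l' n' x : ℂ) =
      if (l, n) = (l', n') then 1 else 0 := by
  obtain ⟨B, hB⟩ := hψ.orthonormal_basis
  rw [← orthonormal_iff_ite.1 B.orthonormal (l, n) (l', n'), L2.inner_def]
  refine integral_congr_ae ?_
  filter_upwards [hB l n, hB l' n'] with x h1 h2
  rw [h1, h2, RCLike.inner_apply, Complex.conj_ofReal, mul_comm]

theorem pairing_wilson_wilson {d : ℕ} {ψ : Fin d → ℝ → ℝ} (hψ : ∀ k, IsWilsonGenerator (ψ k))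
    (p q : Idx d) : pairing (wilson ψ p) (wilson ψ q) = if p = q then 1 else 0 := by
  rw [pairing_wilson]
  unfold wilson
  simp only [← Finset.prod_mul_distrib]
  rw [integral_tensor fun k t =>
    (wilson1 (ψ k) (p.1 k) (p.2 k) t : ℂ) * (wilson1 (ψ k) (q.1 k) (q.2 k) t : ℂ)]
  simp only [(hψ _).integral_mul]
  by_cases hpq : p = q
  · subst hpq; simp
  · rw [if_neg hpq]
    have : ∃ k, (p.1 k, p.2 k) ≠ (q.1 k, q.2 k) := by
      by_contra! hcon
      exact hpq (Prod.ext (funext fun k => (Prod.mk.inj (hcon k)).1)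
        (funext fun k => (Prod.mk.inj (hcon k)).2))
    obtain ⟨k, hk⟩ := this
    exact Finset.prod_eq_zero (Finset.mem_univ k) (if_neg hk)

/-! ### Completeness of the Wilson system -/

/-- Expanding the product gives one monomial of degree 0 or 2 in each variable per subset of
coordinates. The weight makes pairings of `f` with arbitrary tensors of `L²` functions absolutely
convergent. -/
theorem exists_norm_mul_prod_le {d : ℕ} {s h N : ℝ} {f : E d → ℂ} (hh : 0 < h) (hN : 0 ≤ N)
    (hf : gsENorm s h f ≤ ENNReal.ofReal N) :
    ∃ M : ℝ, ∀ x : E d, ‖f x‖ * ∏ k, (1 + x k ^ 2) ≤ M := by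
  refine ⟨∑ t ∈ (Finset.univ : Finset (Fin d)).powerset,
    N * gsDenom s h (fun k => if k ∈ t then 2 else 0) 0, fun x => ?_⟩
  rw [Finset.prod_one_add, Finset.mul_sum]
  refine Finset.sum_le_sum fun t _ => ?_
  have h1 := (gsENorm_le_iff hh hN f).1 hf (fun k => if k ∈ t then 2 else 0) 0 x
  rw [mderiv_zero] at h1
  have h2 : |monomial (fun k => if k ∈ t then 2 else 0) x| = ∏ k ∈ t, x k ^ 2 := by
    rw [monomial, ← abs_of_nonneg (Finset.prod_nonneg fun k (_ : k ∈ t) => sq_nonneg (x k))]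
    congr 1
    rw [← Finset.prod_subset (Finset.subset_univ t)]
    · exact Finset.prod_congr rfl fun k hk => by rw [if_pos hk]
    · intro k _ hk
      simp [hk]
  rw [h2] at h1
  linarith

/-- The square integrable weight `1 / (1 + t²)`. -/
def cauchyWeight (t : ℝ) : ℂ := ((1 + t ^ 2)⁻¹ : ℝ)

theorem memLp_cauchyWeight : MemLp cauchyWeight 2 := by
  have hc : Continuous cauchyWeight := by
    unfold cauchyWeight
    exact Complex.continuous_ofReal.comp
      (Continuous.inv₀ (by fun_prop) fun t => by positivity)
  rw [memLp_two_iff_integrable_sq_norm hc.aestronglyMeasurable]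
  refine integrable_inv_one_add_sq.mono' (by fun_prop) (Filter.Eventually.of_forall fun t => ?_)
  have h0 : 0 < (1 + t ^ 2)⁻¹ := by positivity
  have h1 : (1 + t ^ 2)⁻¹ ≤ 1 := inv_le_one_of_one_le₀ (by nlinarith)
  rw [cauchyWeight, Complex.norm_real, Real.norm_of_nonneg h0.le, Real.norm_of_nonneg (by positivity)]
  nlinarith

theorem integrable_cauchyWeight_mul {u : ℝ → ℂ} (hu : MemLp u 2) :
    Integrable fun t => cauchyWeight t * u t :=
  memLp_cauchyWeight.integrable_mul hu

theorem integral_norm_cauchyWeight_mul_le (u : Lp ℂ 2 (volume : Measure ℝ)) :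
    ∫ t, ‖cauchyWeight t * u t‖ ≤ (eLpNorm cauchyWeight 2 volume).toReal * ‖u‖ := by
  have h1 : (∫ t, ‖cauchyWeight t * u t‖) = (eLpNorm (cauchyWeight • (u : ℝ → ℂ)) 1 volume).toReal := by
    rw [eLpNorm_one_eq_lintegral_enorm]
    exact integral_norm_eq_lintegral_enorm (memLp_cauchyWeight.1.mul (Lp.memLp u).1)
  rw [h1, Lp.norm_def, ← ENNReal.toReal_mul]
  exact ENNReal.toReal_mono
    (ENNReal.mul_ne_top memLp_cauchyWeight.eLpNorm_ne_top (Lp.memLp u).eLpNorm_ne_top)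
    (eLpNorm_smul_le_mul_eLpNorm (Lp.memLp u).1 memLp_cauchyWeight.1)

/-- Needed because elements of `Lp` are determined only almost everywhere: a null set in one
coordinate must pull back to a null set of `ℝ^d`. -/
theorem quasiMeasurePreserving_coord {d : ℕ} (i : Fin d) :
    Measure.QuasiMeasurePreserving (fun x : E d => x i) volume volume :=
  (Measure.quasiMeasurePreserving_eval (fun _ : Fin d => (volume : Measure ℝ)) i).comp
    (EuclideanSpace.volume_preserving_symm_measurableEquiv_toLp (Fin d)).quasiMeasurePreserving

section Tensor

variable {d : ℕ} {f : E d → ℂ} {M : ℝ}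

theorem mul_tensor_eq (f : E d → ℂ) (g : Fin d → ℝ → ℂ) (x : E d) :
    f x * ∏ k, g k (x k) =
      (f x * ∏ k, ((1 + x k ^ 2 : ℝ) : ℂ)) * ∏ k, (cauchyWeight (x k) * g k (x k)) := by
  rw [Finset.prod_mul_distrib, ← mul_assoc, mul_assoc (f x), ← Finset.prod_mul_distrib]
  have : ∏ k, (((1 + x k ^ 2 : ℝ) : ℂ) * cauchyWeight (x k)) = 1 := by
    refine Finset.prod_eq_one fun k _ => ?_
    rw [cauchyWeight, ← Complex.ofReal_mul, mul_inv_cancel₀ (by positivity), Complex.ofReal_one]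
  rw [this, mul_one]

theorem norm_mul_prod_eq (f : E d → ℂ) (x : E d) :
    ‖f x * ∏ k, ((1 + x k ^ 2 : ℝ) : ℂ)‖ = ‖f x‖ * ∏ k, (1 + x k ^ 2) := by
  rw [norm_mul, norm_prod]
  congr 1
  refine Finset.prod_congr rfl fun k _ => ?_
  rw [Complex.norm_real, Real.norm_of_nonneg (by positivity)]

theorem integrable_mul_tensor (hfc : Continuous f) (hM : ∀ x : E d, ‖f x‖ * ∏ k, (1 + x k ^ 2) ≤ M)
    {g : Fin d → ℝ → ℂ} (hg : ∀ k, MemLp (g k) 2) :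
    Integrable fun x : E d => f x * ∏ k, g k (x k) := by
  simp only [mul_tensor_eq f g]
  refine (integrable_tensor (g := fun k t => cauchyWeight t * g k t) fun k =>
    integrable_cauchyWeight_mul (hg k)).bdd_mul (c := M) (Continuous.aestronglyMeasurable ?_)
    (Filter.Eventually.of_forall fun x => (norm_mul_prod_eq f x).trans_le (hM x))
  exact hfc.mul (continuous_finsetProd _ fun k _ => Complex.continuous_ofReal.comp (by fun_prop))

theorem norm_integral_mul_tensor_le (hM : ∀ x : E d, ‖f x‖ * ∏ k, (1 + x k ^ 2) ≤ M)
    {g : Fin d → ℝ → ℂ} (hg : ∀ k, MemLp (g k) 2) :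
    ‖∫ x : E d, f x * ∏ k, g k (x k)‖ ≤ M * ∏ k, ∫ t, ‖cauchyWeight t * g k t‖ := by
  rw [← integral_tensor fun k t => ‖cauchyWeight t * g k t‖, ← integral_const_mul]
  refine norm_integral_le_of_norm_le ((integrable_tensor
    (g := fun k t => ‖cauchyWeight t * g k t‖) fun k =>
      (integrable_cauchyWeight_mul (hg k)).norm).const_mul M)
    (Filter.Eventually.of_forall fun x => ?_)
  rw [mul_tensor_eq, norm_mul, norm_mul_prod_eq, norm_prod]
  exact mul_le_mul_of_nonneg_right (hM x) (Finset.prod_nonneg fun _ _ => norm_nonneg _)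

theorem update_tensor_eq (g : Fin d → ℝ → ℂ) (i : Fin d) (u : ℝ → ℂ) (x : E d) :
    ∏ k, Function.update g i u k (x k) = u (x i) * ∏ k ∈ Finset.univ.erase i, g k (x k) := by
  rw [← Finset.mul_prod_erase _ _ (Finset.mem_univ i), Function.update_self]
  congr 1
  exact Finset.prod_congr rfl fun k hk => by rw [Function.update_of_ne (Finset.mem_erase.1 hk).1]

theorem memLp_update {g : Fin d → ℝ → ℂ} (hg : ∀ k, MemLp (g k) 2) (i : Fin d) {u : ℝ → ℂ}
    (hu : MemLp u 2) (k : Fin d) : MemLp (Function.update g i u k) 2 := by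
  by_cases hk : k = i
  · subst hk; rwa [Function.update_self]
  · rw [Function.update_of_ne hk]; exact hg k

theorem integral_update_congr (g : Fin d → ℝ → ℂ) (i : Fin d) {u v : ℝ → ℂ}
    (huv : u =ᵐ[volume] v) :
    ∫ x : E d, f x * ∏ k, Function.update g i u k (x k) =
      ∫ x : E d, f x * ∏ k, Function.update g i v k (x k) := by
  refine integral_congr_ae ?_
  filter_upwards [(quasiMeasurePreserving_coord i).ae huv] with x hx
  rw [update_tensor_eq, update_tensor_eq, hx]

/-- The pairing of `f` with a tensor product, as a continuous linear form in one factor. -/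
theorem exists_clm_integral_update (hfc : Continuous f)
    (hM : ∀ x : E d, ‖f x‖ * ∏ k, (1 + x k ^ 2) ≤ M) {g : Fin d → ℝ → ℂ}
    (hg : ∀ k, MemLp (g k) 2) (i : Fin d) :
    ∃ Λ : Lp ℂ 2 (volume : Measure ℝ) →L[ℂ] ℂ,
      ∀ u, Λ u = ∫ x : E d, f x * ∏ k, Function.update g i u k (x k) := by
  have hint : ∀ u : Lp ℂ 2 (volume : Measure ℝ),
      Integrable fun x : E d => f x * ∏ k, Function.update g i u k (x k) := fun u =>
    integrable_mul_tensor hfc hM (memLp_update hg i (Lp.memLp u))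
  refine ⟨LinearMap.mkContinuous
    { toFun := fun u => ∫ x : E d, f x * ∏ k, Function.update g i u k (x k)
      map_add' := fun u v => ?_
      map_smul' := fun c u => ?_ }
    (M * ((eLpNorm cauchyWeight 2 volume).toReal *
      ∏ k ∈ Finset.univ.erase i, ∫ t, ‖cauchyWeight t * g k t‖)) (fun u => ?_), fun u => rfl⟩
  · rw [integral_update_congr g i (Lp.coeFn_add u v), ← integral_add (hint u) (hint v)]
    congr 1
    funext x
    simp only [update_tensor_eq, Pi.add_apply]
    ring
  · rw [integral_update_congr g i (Lp.coeFn_smul c u), RingHom.id_apply, smul_eq_mul,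
      ← integral_const_mul]
    congr 1
    funext x
    simp only [update_tensor_eq, Pi.smul_apply, smul_eq_mul]
    ring
  · have hM0 : 0 ≤ M := le_trans (by positivity) (hM 0)
    refine (norm_integral_mul_tensor_le hM (memLp_update hg i (Lp.memLp u))).trans ?_
    rw [← Finset.mul_prod_erase _ _ (Finset.mem_univ i), Function.update_self]
    have h1 : ∏ k ∈ Finset.univ.erase i, ∫ t, ‖cauchyWeight t * Function.update g i u k t‖ =
        ∏ k ∈ Finset.univ.erase i, ∫ t, ‖cauchyWeight t * g k t‖ :=
      Finset.prod_congr rfl fun k hk => by rw [Function.update_of_ne (Finset.mem_erase.1 hk).1]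
    have h2 : 0 ≤ ∏ k ∈ Finset.univ.erase i, ∫ t, ‖cauchyWeight t * g k t‖ :=
      Finset.prod_nonneg fun _ _ => integral_nonneg fun _ => norm_nonneg _
    rw [h1]
    calc _ ≤ M * ((eLpNorm cauchyWeight 2 volume).toReal * ‖u‖ *
          ∏ k ∈ Finset.univ.erase i, ∫ t, ‖cauchyWeight t * g k t‖) := by
          gcongr
          exact integral_norm_cauchyWeight_mul_le u
      _ = _ := by ring

/-- Wilson factors are exchanged for arbitrary `L²` factors one coordinate at a time, `S` being the
set of coordinates already freed. In the coordinate being freed, the integral is a continuous linear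
form that vanishes on a one-dimensional Wilson basis, hence everywhere. Completeness in `L²(ℝ)` is
thus enough. -/
theorem integral_mul_tensor_eq_zero {ψ : Fin d → ℝ → ℝ} (hψ : ∀ k, IsWilsonGenerator (ψ k))
    (hfc : Continuous f) (hM : ∀ x : E d, ‖f x‖ * ∏ k, (1 + x k ^ 2) ≤ M)
    (h0 : ∀ p, pairing f (wilson ψ p) = 0) {g : Fin d → ℝ → ℂ} (hg : ∀ k, MemLp (g k) 2) :
    ∫ x : E d, f x * ∏ k, g k (x k) = 0 := by
  have key : ∀ (S : Finset (Fin d)) (g : Fin d → ℝ → ℂ), (∀ k, MemLp (g k) 2) →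
      (∀ k ∉ S, ∃ (l : ℕ) (n : ℤ), g k = fun t => (wilson1 (ψ k) l n t : ℂ)) →
      ∫ x : E d, f x * ∏ k, g k (x k) = 0 := by
    intro S
    induction S using Finset.induction_on with
    | empty =>
      intro g _ hgw
      choose l n hln using fun k => hgw k (Finset.notMem_empty k)
      rw [← h0 (l, n), pairing_wilson]
      simp only [hln]
      rfl
    | insert i S hi ih =>
      intro g hg hgw
      obtain ⟨Λ, hΛ⟩ := exists_clm_integral_update hfc hM hg i
      obtain ⟨B, hB⟩ := (hψ i).orthonormal_basis
      have hΛ0 : Λ = 0 := by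
        refine ContinuousLinearMap.ext_on
          (Submodule.dense_iff_topologicalClosure_eq_top.2 B.dense_span) ?_
        rintro _ ⟨⟨l, n⟩, rfl⟩
        rw [hΛ, integral_update_congr g i (hB l n), _root_.zero_apply]
        refine ih _ (memLp_update hg i ((hψ i).memLp l n)) fun k hk => ?_
        by_cases hki : k = i
        · subst hki
          exact ⟨l, n, by rw [Function.update_self]⟩
        · rw [Function.update_of_ne hki]
          exact hgw k (by simp [hki, hk])
      have h1 := hΛ ((hg i).toLp (g i))
      rw [integral_update_congr g i (hg i).coeFn_toLp, Function.update_eq_self, hΛ0] at h1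
      exact h1.symm
  exact key Finset.univ g hg fun k hk => absurd (Finset.mem_univ k) hk

/-- The indicator of a cube is a tensor product. On a small cube around a point where `f` does not
vanish, `f` stays within half its size of its central value, so its integral is nonzero. -/
theorem eq_zero_of_integral_mul_tensor (hfc : Continuous f)
    (h0 : ∀ g : Fin d → ℝ → ℂ, (∀ k, MemLp (g k) 2) → ∫ x : E d, f x * ∏ k, g k (x k) = 0) :
    f = 0 := by
  funext x₀
  by_contra hne
  have hpos : 0 < ‖f x₀‖ := norm_pos_iff.2 hne
  obtain ⟨r, hr, hball⟩ := Metric.continuousAt_iff.1 hfc.continuousAt (‖f x₀‖ / 2) (half_pos hpos)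
  -- Chosen so that `d * δ < r`, which puts the cube inside the ball; the added 1 also covers `d =
  -- 0`.
  set δ : ℝ := r / (d + 1) with hδ
  have hδ0 : 0 < δ := by positivity
  set Q : Set (E d) := {x | ∀ k, x k ∈ Metric.closedBall (x₀ k) δ} with hQ
  have hQm : MeasurableSet Q := by
    rw [hQ, Set.ofPred_forall]
    exact MeasurableSet.iInter fun k =>
      (Metric.isClosed_closedBall.preimage (by fun_prop : Continuous fun x : E d => x k)).measurableSet
  have hQr : Q ⊆ Metric.ball x₀ r := by
    intro x hx
    rw [mem_ball_iff_norm]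
    calc ‖x - x₀‖ ≤ ∑ k, |(x - x₀) k| := norm_le_sum_abs _
      _ ≤ ∑ _k : Fin d, δ := Finset.sum_le_sum fun k _ => by
          simpa [Real.dist_eq] using hx k
      _ = d * δ := by simp
      _ < r := by
          rw [hδ, mul_div_assoc', div_lt_iff₀ (by positivity)]
          nlinarith
  have hrQ : Metric.ball x₀ δ ⊆ Q := by
    intro x hx k
    rw [mem_ball_iff_norm] at hx
    rw [mem_closedBall_iff_norm]
    exact (PiLp.norm_apply_le (x - x₀) k).trans hx.le
  have hvpos : 0 < volume.real Q :=
    ENNReal.toReal_pos ((Metric.measure_ball_pos volume x₀ hδ0).trans_le (measure_mono hrQ)).ne'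
      ((measure_mono hQr).trans_lt measure_ball_lt_top).ne
  have hvtop : volume Q < ⊤ := (measure_mono hQr).trans_lt measure_ball_lt_top
  have hind : ∀ x : E d, f x * ∏ k, (Metric.closedBall (x₀ k) δ).indicator (fun _ => (1 : ℂ)) (x k) =
      Q.indicator f x := by
    intro x
    by_cases hx : x ∈ Q
    · rw [Set.indicator_of_mem hx, Finset.prod_eq_one, mul_one]
      exact fun k _ => Set.indicator_of_mem (hx k) _
    · rw [Set.indicator_of_notMem hx]
      obtain ⟨k, hk⟩ := not_forall.1 hx
      rw [Finset.prod_eq_zero (Finset.mem_univ k) (Set.indicator_of_notMem hk _), mul_zero]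
  have h1 := h0 (fun k => (Metric.closedBall (x₀ k) δ).indicator fun _ => (1 : ℂ)) fun k =>
    memLp_indicator_const 2 Metric.isClosed_closedBall.measurableSet 1
      (Or.inr measure_closedBall_lt_top.ne)
  simp only [hind] at h1
  rw [integral_indicator hQm] at h1
  have hbd : ∀ x ∈ Q, ‖f x - f x₀‖ ≤ ‖f x₀‖ / 2 := fun x hx => by
    have := hball (hQr hx)
    rw [dist_eq_norm] at this
    exact this.le
  have hfi : IntegrableOn f Q := by
    refine Measure.integrableOn_of_bounded (M := ‖f x₀‖ / 2 + ‖f x₀‖) hvtop.ne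
      hfc.aestronglyMeasurable ((ae_restrict_iff' hQm).2 (Filter.Eventually.of_forall fun x hx => ?_))
    have := norm_le_norm_sub_add (f x) (f x₀)
    linarith [hbd x hx]
  have h2 := norm_setIntegral_le_of_norm_le_const hvtop hbd
  rw [integral_sub hfi (integrableOn_const hvtop.ne), h1, setIntegral_const, zero_sub, norm_neg,
    norm_smul, Real.norm_of_nonneg hvpos.le] at h2
  nlinarith

end Tensor

/-- A function in a step that is orthogonal to all Wilson functions vanishes. -/
theorem eq_zero_of_pairing_eq_zero {d : ℕ} {s h : ℝ} {ψ : Fin d → ℝ → ℝ}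
    (hψ : ∀ k, IsWilsonGenerator (ψ k)) {f : E d → ℂ} (hh : 0 < h) (hfc : Continuous f)
    (hf : gsENorm s h f < ⊤) (h0 : ∀ p, pairing f (wilson ψ p) = 0) : f = 0 := by
  obtain ⟨N, hN, hfN⟩ := exists_gsENorm_le hf
  obtain ⟨M, hM⟩ := exists_norm_mul_prod_le hh hN hfN
  exact eq_zero_of_integral_mul_tensor hfc fun g hg =>
    integral_mul_tensor_eq_zero hψ hfc hM h0 hg

/-! ### Summability of stretched exponentials -/

theorem exp_neg_rpow_le {s k t : ℝ} (hs : 0 < s) (hk : 0 < k) (ht : 0 < t) :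
    Real.exp (-(k * t ^ (1 / s))) ≤ ((s / k) ^ s) ^ 2 * 2 ^ s * (1 / t ^ 2) := by
  have hh : 0 < (s / k) ^ s := by positivity
  -- The radius `(s / k) ^ s` turns the exponent into exactly `k * t ^ (1 / s)`; the power 2 gives a
  -- summable majorant.
  have h := pow_le_exp_mul_gevrey hs hh ht.le 2
  have h1 : s * (t / (s / k) ^ s) ^ (1 / s) = k * t ^ (1 / s) := by
    rw [Real.div_rpow ht.le hh.le, ← Real.rpow_mul (by positivity), mul_one_div_cancel hs.ne',
      Real.rpow_one]
    field_simp
  rw [h1] at h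
  rw [Real.exp_neg, mul_one_div, inv_eq_one_div, div_le_div_iff₀ (Real.exp_pos _) (by positivity)]
  simp only [Nat.factorial_two, Nat.cast_ofNat] at h
  linarith

theorem summable_exp_neg_rpow_nat {s k : ℝ} (hs : 0 < s) (hk : 0 < k) :
    Summable fun n : ℕ => Real.exp (-(k * (n : ℝ) ^ (1 / s))) := by
  rw [← summable_nat_add_iff 1]
  have h1 : Summable fun n : ℕ => ((s / k) ^ s) ^ 2 * 2 ^ s * (1 / ((n + 1 : ℕ) : ℝ) ^ 2) :=
    ((summable_nat_add_iff 1).2 (Real.summable_one_div_nat_pow.2 one_lt_two)).mul_left _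
  exact Summable.of_nonneg_of_le (fun _ => (Real.exp_pos _).le)
    (fun n => exp_neg_rpow_le hs hk (by positivity)) h1

theorem summable_exp_neg_rpow_int {s k : ℝ} (hs : 0 < s) (hk : 0 < k) :
    Summable fun n : ℤ => Real.exp (-(k * |(n : ℝ) / 2| ^ (1 / s))) := by
  have h1 : Summable fun n : ℕ => Real.exp (-(k * |((n : ℤ) : ℝ) / 2| ^ (1 / s))) := by
    refine (summable_exp_neg_rpow_nat hs (k := k * (1 / 2) ^ (1 / s)) (by positivity)).congr
      fun n => ?_
    rw [mul_assoc, ← Real.mul_rpow (by positivity) (by positivity), Int.cast_natCast,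
      abs_of_nonneg (by positivity)]
    congr 4
    ring
  refine Summable.of_nat_of_neg h1 (h1.congr fun n => ?_)
  congr 4
  push_cast
  rw [neg_div, abs_neg]

/-- Any finite set of tuples lies in a finite box, over which the sum factors. -/
theorem summable_prod_apply {ι α : Type*} [Fintype ι] {f : α → ℝ} (hf0 : ∀ x, 0 ≤ f x)
    (hf : Summable f) : Summable fun x : ι → α => ∏ i, f (x i) := by
  classical
  refine summable_of_sum_le (c := ∏ _i : ι, ∑' a, f a)
    (fun x => Finset.prod_nonneg fun i _ => hf0 _) fun S => ?_
  set T : Finset α := S.biUnion fun x => Finset.univ.image x with hT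
  calc ∑ x ∈ S, ∏ i, f (x i) ≤ ∑ x ∈ Fintype.piFinset fun _ : ι => T, ∏ i, f (x i) := by
        refine Finset.sum_le_sum_of_subset_of_nonneg (fun x hx => ?_)
          fun x _ _ => Finset.prod_nonneg fun i _ => hf0 _
        exact Fintype.mem_piFinset.2 fun i =>
          Finset.mem_biUnion.2 ⟨x, hx, Finset.mem_image_of_mem _ (Finset.mem_univ i)⟩
    _ = ∏ _i : ι, ∑ a ∈ T, f a := (Finset.prod_univ_sum (fun _ => T) fun _ a => f a).symm
    _ ≤ _ := Finset.prod_le_prod (fun i _ => Finset.sum_nonneg fun a _ => hf0 a)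
        fun i _ => hf.sum_le_tsum T fun a _ => hf0 a

theorem summable_exp_neg_idxSize {d : ℕ} {s k : ℝ} (hs : 0 < s) (hk : 0 < k) :
    Summable fun p : Idx d => Real.exp (-(k * idxSize p ^ (1 / s))) := by
  -- Each of the `2 * d` coordinates is at most `idxSize p`, so the exponent is shared among them;
  -- the added 1 avoids a zero denominator.
  set κ : ℝ := k / (2 * d + 1) with hκ
  have hκ0 : 0 < κ := by positivity
  have h1 := summable_prod_apply (ι := Fin d) (fun _ => (Real.exp_pos _).le)
    (summable_exp_neg_rpow_nat hs hκ0)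
  have h2 := summable_prod_apply (ι := Fin d) (fun _ => (Real.exp_pos _).le)
    (summable_exp_neg_rpow_int hs hκ0)
  refine Summable.of_nonneg_of_le (fun _ => (Real.exp_pos _).le) (fun p => ?_)
    (h1.mul_of_nonneg h2 (fun _ => Finset.prod_nonneg fun _ _ => (Real.exp_pos _).le)
      fun _ => Finset.prod_nonneg fun _ _ => (Real.exp_pos _).le)
  rw [← Real.exp_sum, ← Real.exp_sum, ← Real.exp_add]
  refine Real.exp_le_exp.2 ?_
  rw [Finset.sum_neg_distrib, Finset.sum_neg_distrib, ← neg_add, ← Finset.sum_add_distrib]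
  refine neg_le_neg ?_
  have hσ := Real.rpow_nonneg (idxSize_nonneg p) (1 / s)
  calc ∑ i, (κ * (p.1 i : ℝ) ^ (1 / s) + κ * |(p.2 i : ℝ) / 2| ^ (1 / s))
      ≤ ∑ _i : Fin d, (κ * idxSize p ^ (1 / s) + κ * idxSize p ^ (1 / s)) := by
        refine Finset.sum_le_sum fun i _ => ?_
        have h3 := fst_le_idxSize p i
        have h4 := abs_snd_le_idxSize p i
        gcongr
    _ = κ * (2 * d) * idxSize p ^ (1 / s) := by simp; ring
    _ ≤ κ * (2 * d + 1) * idxSize p ^ (1 / s) := by gcongr; linarith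
    _ = _ := by rw [hκ, div_mul_cancel₀ _ (by positivity)]

/-! ### Weighted sequences -/

theorem weightedSummable_of_le {d : ℕ} {s k k' A : ℝ} (hs : 0 < s) (hk : k' < k)
    {c : Idx d → ℂ} (hc : ∀ p, ‖c p‖ ≤ A * Real.exp (-(k * idxSize p ^ (1 / s)))) :
    WeightedSummable s k' c := by
  refine Summable.of_nonneg_of_le (fun p => by positivity) (fun p => ?_)
    ((summable_exp_neg_idxSize (d := d) hs (k := 2 * (k - k')) (by linarith)).mul_left (A ^ 2))
  calc ‖c p‖ ^ 2 * Real.exp (2 * k' * idxSize p ^ (1 / s))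
      ≤ (A * Real.exp (-(k * idxSize p ^ (1 / s)))) ^ 2 *
        Real.exp (2 * k' * idxSize p ^ (1 / s)) := by
        gcongr
        exact hc p
    _ = _ := by
        rw [mul_pow, ← Real.exp_nat_mul, mul_assoc, ← Real.exp_add]
        congr 2
        push_cast
        ring

theorem WeightedSummable.exists_norm_le {d : ℕ} {s k : ℝ} {c : Idx d → ℂ}
    (hc : WeightedSummable s k c) :
    ∃ A : ℝ, ∀ p, ‖c p‖ ≤ A * Real.exp (-(k * idxSize p ^ (1 / s))) := by
  set S := ∑' p, ‖c p‖ ^ 2 * Real.exp (2 * k * idxSize p ^ (1 / s)) with hS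
  refine ⟨√S, fun p => ?_⟩
  have h1 : ‖c p‖ ^ 2 * Real.exp (2 * k * idxSize p ^ (1 / s)) ≤ S :=
    hc.le_tsum p fun q _ => by positivity
  rw [Real.exp_neg, ← div_eq_mul_inv, le_div_iff₀ (Real.exp_pos _)]
  refine Real.le_sqrt_of_sq_le ?_
  rw [mul_pow, ← Real.exp_nat_mul]
  refine le_of_eq_of_le ?_ h1
  congr 2
  push_cast
  ring

/-! ### Series of Wilson functions -/

theorem gsENorm_tsum_le {d : ℕ} {s h : ℝ} (hh : 0 < h) {ι : Type*}
    {J : ι → (Fin d → ℕ) → E d → ℂ} (hJ : ∀ p, IsJet (J p)) {v : ι → ℝ} (hv : Summable v)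
    (hb : ∀ p α β x, |monomial α x| * ‖J p β x‖ ≤ v p * gsDenom s h α β) :
    IsJet (fun β x => ∑' p, J p β x) ∧
      gsENorm s h (fun x => ∑' p, J p 0 x) ≤ ENNReal.ofReal (∑' p, v p) := by
  have hb0 : ∀ p β x, ‖J p β x‖ ≤ v p * gsDenom s h 0 β := fun p β x => by
    simpa [monomial_zero] using hb p 0 β x
  have hv0 : ∀ p, 0 ≤ v p := fun p =>
    nonneg_of_mul_nonneg_left ((norm_nonneg _).trans (hb0 p 0 0)) (gsDenom_pos s hh _ _)
  have hjet : IsJet (fun β x => ∑' p, J p β x) := IsJet.tsum hJ fun β =>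
    ⟨fun p => v p * gsDenom s h 0 β, hv.mul_right _, fun p x => hb0 p β x⟩
  refine ⟨hjet, (gsENorm_le_iff hh (tsum_nonneg hv0) _).2 fun α β x => ?_⟩
  rw [hjet.mderiv_eq β, ← tsum_mul_right]
  have h1 : Summable fun p => ‖J p β x‖ :=
    Summable.of_nonneg_of_le (fun _ => norm_nonneg _) (fun p => hb0 p β x) (hv.mul_right _)
  calc |monomial α x| * ‖∑' p, J p β x‖ ≤ |monomial α x| * ∑' p, ‖J p β x‖ := by
        gcongr
        exact norm_tsum_le_tsum_norm h1
    _ = ∑' p, |monomial α x| * ‖J p β x‖ := tsum_mul_left.symm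
    _ ≤ _ := (h1.mul_left _).tsum_le_tsum (fun p => hb p α β x) (hv.mul_right _)

/-- The sum of a series of Wilson functions. -/
def wilsonSeries {d : ℕ} (ψ : Fin d → ℝ → ℝ) (c : Idx d → ℂ) (x : E d) : ℂ :=
  ∑' p, c p * wilson ψ p x

namespace IsWindowFamily

variable {d : ℕ} {ψ : Fin d → ℝ → ℝ} {Ψ : Fin d → ℕ → ℝ → ℂ} {C a H : ℝ}

theorem contDiff_wilson (hΨ : IsWindowFamily ψ Ψ C a H) (p : Idx d) :
    ContDiff ℝ ∞ (wilson ψ p) := by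
  rw [← hΨ.wilsonJet_zero]
  exact (hΨ.isJet_wilsonJet p).contDiff 0

theorem gsENorm_wilson_lt_top (hΨ : IsWindowFamily ψ Ψ C a H) {s h : ℝ} (hs : 1 < s) (hh : 0 < h)
    (p : Idx d) : gsENorm s h (wilson ψ p) < ⊤ := by
  obtain ⟨C', hC', hb⟩ := hΨ.exists_wilsonJet_bound hs hh
  refine lt_of_le_of_lt ((gsENorm_le_iff hh (by positivity) _).2 fun α β x => ?_)
    (ENNReal.ofReal_lt_top (r := C' * Real.exp (d * (2 * s *
      (4 * Real.pi / h * idxSize p) ^ (1 / s)))))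
  rw [hΨ.mderiv_wilson]
  exact hb p α β x

/-- A series of Wilson functions with rapidly decreasing coefficients converges in a step, and its
coefficients are recovered by the pairing. -/
theorem wilsonSeries_spec (hΨ : IsWindowFamily ψ Ψ C a H) (hψ : ∀ k, IsWilsonGenerator (ψ k))
    {s h k A : ℝ} (hs : 1 < s) (hh : 0 < h)
    (hk : d * (2 * s * (4 * Real.pi / h) ^ (1 / s)) < k) {c : Idx d → ℂ}
    (hc : ∀ p, ‖c p‖ ≤ A * Real.exp (-(k * idxSize p ^ (1 / s)))) :
    ContDiff ℝ ∞ (wilsonSeries ψ c) ∧ gsENorm s h (wilsonSeries ψ c) < ⊤ ∧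
      Filter.Tendsto (fun S : Finset (Idx d) =>
        gsENorm s h (∑ p ∈ S, c p • wilson ψ p - wilsonSeries ψ c)) Filter.atTop (𝓝 0) ∧
      ∀ q, pairing (wilsonSeries ψ c) (wilson ψ q) = c q := by
  have hs0 : 0 < s := by linarith
  obtain ⟨C', hC', hb⟩ := hΨ.exists_wilsonJet_bound hs hh
  set W : Idx d → ℝ := fun p =>
    C' * Real.exp (d * (2 * s * (4 * Real.pi / h * idxSize p) ^ (1 / s))) with hW
  set v : Idx d → ℝ := fun p => ‖c p‖ * W p with hv
  have hv0 : ∀ p, 0 ≤ v p := fun p => by positivity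
  -- Coefficient decay at rate `k` beats norm growth at rate `κ < k`, leaving a summable stretched
  -- exponential of rate `k - κ`.
  have hvs : Summable v := by
    set κ := d * (2 * s * (4 * Real.pi / h) ^ (1 / s)) with hκ
    refine Summable.of_nonneg_of_le hv0 (fun p => ?_)
      ((summable_exp_neg_idxSize (d := d) hs0 (k := k - κ) (by linarith)).mul_left (A * C'))
    have h1 : d * (2 * s * (4 * Real.pi / h * idxSize p) ^ (1 / s)) = κ * idxSize p ^ (1 / s) := by
      rw [Real.mul_rpow (by have := Real.pi_pos; positivity) (idxSize_nonneg p), hκ]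
      ring
    simp only [hv, hW, h1]
    calc _ ≤ A * Real.exp (-(k * idxSize p ^ (1 / s))) *
          (C' * Real.exp (κ * idxSize p ^ (1 / s))) := by
          gcongr
          exact hc p
      _ = A * C' * (Real.exp (-(k * idxSize p ^ (1 / s))) *
          Real.exp (κ * idxSize p ^ (1 / s))) := by ring
      _ = _ := by
          rw [← Real.exp_add]
          congr 2
          ring
  set J : Idx d → (Fin d → ℕ) → E d → ℂ := fun p β x => c p * wilsonJet Ψ p β x with hJdef
  have hJ : ∀ p, IsJet (J p) := fun p => (hΨ.isJet_wilsonJet p).const_mul (c p)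
  have hJb : ∀ p α β x, |monomial α x| * ‖J p β x‖ ≤ v p * gsDenom s h α β := by
    intro p α β x
    simp only [hJdef, hv, norm_mul]
    calc _ = ‖c p‖ * (|monomial α x| * ‖wilsonJet Ψ p β x‖) := by ring
      _ ≤ ‖c p‖ * (W p * gsDenom s h α β) :=
        mul_le_mul_of_nonneg_left (hb p α β x) (norm_nonneg _)
      _ = _ := by ring
  have hJ0 : ∀ p x, J p 0 x = c p * wilson ψ p x := fun p x => by
    simp only [hJdef, hΨ.wilsonJet_zero]
  have hser : wilsonSeries ψ c = fun x => ∑' p, J p 0 x := by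
    funext x; simp only [wilsonSeries, hJ0]
  have hJn : ∀ p x, ‖J p 0 x‖ ≤ v p := fun p x => by
    simpa [monomial_zero, gsDenom] using hJb p 0 0 x
  obtain ⟨hjet, hnorm⟩ := gsENorm_tsum_le hh hJ hvs hJb
  refine ⟨hser ▸ hjet.contDiff 0, ?_, ?_, fun q => ?_⟩
  · rw [hser]
    exact hnorm.trans_lt ENNReal.ofReal_lt_top
  · have hle : ∀ S : Finset (Idx d),
        gsENorm s h (∑ p ∈ S, c p • wilson ψ p - wilsonSeries ψ c) ≤
          ENNReal.ofReal (∑' p : {p // p ∉ S}, v p) := by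
      intro S
      obtain ⟨hjet', hnorm'⟩ := gsENorm_tsum_le hh (ι := {p // p ∉ S}) (J := fun p => J p)
        (fun p => hJ p) (hvs.subtype _) (fun p => hJb p)
      -- The error is minus the series over the complement of `S`, so its norm is at most a tail of
      -- `∑ v`. Taking the limit over all finite sets is unconditional convergence.
      have h1 : ∑ p ∈ S, c p • wilson ψ p - wilsonSeries ψ c =
          (-1 : ℂ) • fun x => ∑' p : {p // p ∉ S}, J p 0 x := by
        funext x
        have h2 : Summable fun p => J p 0 x := Summable.of_norm_bounded hvs fun p => hJn p x
        have h3 := h2.sum_add_tsum_subtype_compl S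
        simp only [hser, Pi.sub_apply, Finset.sum_apply, Pi.smul_apply, smul_eq_mul, ← hJ0, ← h3]
        ring
      rw [h1, gsENorm_smul s h (-1) (hjet'.contDiff 0)]
      simpa using hnorm'
    have hlim : Filter.Tendsto (fun S : Finset (Idx d) => ENNReal.ofReal (∑' p : {p // p ∉ S}, v p))
        Filter.atTop (𝓝 0) := by
      rw [← ENNReal.ofReal_zero]
      exact (ENNReal.continuous_ofReal.tendsto 0).comp (tendsto_tsum_compl_atTop_zero v)
    exact tendsto_of_tendsto_of_tendsto_of_le_of_le tendsto_const_nhds hlim (fun _ => zero_le)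
      hle
  · rw [pairing_wilson]
    have hint : ∀ p, Integrable fun x => J p 0 x * wilson ψ q x := fun p =>
      (hΨ.integrable_wilson q).bdd_mul (c := v p) ((hJ p).contDiff 0).continuous.aestronglyMeasurable
        (Filter.Eventually.of_forall (hJn p))
    -- Sum and integral are exchanged, and orthonormality leaves only the term with index `q`.
    have h1 := hasSum_integral_of_summable_integral_norm hint (by
      refine Summable.of_nonneg_of_le (fun p => integral_nonneg fun _ => norm_nonneg _) (fun p => ?_)
        (hvs.mul_right (∫ x, ‖wilson ψ q x‖))
      rw [← integral_const_mul]
      refine integral_mono (hint p).norm ((hΨ.integrable_wilson q).norm.const_mul _) fun x => ?_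
      simp only [norm_mul (J p 0 x)]
      gcongr
      exact hJn p x)
    have h2 : ∀ p, ∫ x, J p 0 x * wilson ψ q x = if p = q then c q else 0 := by
      intro p
      simp only [hJ0, mul_assoc]
      rw [integral_const_mul, ← pairing_wilson, pairing_wilson_wilson hψ]
      split_ifs with hpq
      · rw [hpq, mul_one]
      · rw [mul_zero]
    simp only [h2] at h1
    rw [hser]
    simp only [← tsum_mul_right]
    exact h1.unique (hasSum_ite_eq q (c q))

theorem integrable_mul_wilson (hΨ : IsWindowFamily ψ Ψ C a H) {s h : ℝ} (hh : 0 < h)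
    {f : E d → ℂ} (hfc : Continuous f) (hf : gsENorm s h f < ⊤) (p : Idx d) :
    Integrable fun x => f x * wilson ψ p x := by
  obtain ⟨N, hN, hfN⟩ := exists_gsENorm_le hf
  exact (hΨ.integrable_wilson p).bdd_mul (c := N) hfc.aestronglyMeasurable
    (Filter.Eventually.of_forall fun x => norm_le_of_gsENorm_le hh hN hfN x)

/-- Functions in a step are determined by their Wilson coefficients. -/
theorem eq_of_pairing_eq (hΨ : IsWindowFamily ψ Ψ C a H) (hψ : ∀ k, IsWilsonGenerator (ψ k))
    {s h : ℝ} (hh : 0 < h) {f g : E d → ℂ} (hfc : ContDiff ℝ ∞ f) (hgc : ContDiff ℝ ∞ g)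
    (hf : gsENorm s h f < ⊤) (hg : gsENorm s h g < ⊤)
    (hfg : ∀ p, pairing f (wilson ψ p) = pairing g (wilson ψ p)) : f = g := by
  have hmem : f - g ∈ stepSubmodule d s ⟨h, hh⟩ := Submodule.sub_mem _ ⟨hfc, hf⟩ ⟨hgc, hg⟩
  refine sub_eq_zero.1 (eq_zero_of_pairing_eq_zero hψ hh hmem.1.continuous hmem.2 fun p => ?_)
  rw [pairing_wilson]
  simp only [Pi.sub_apply, sub_mul]
  rw [integral_sub (hΨ.integrable_mul_wilson hh hfc.continuous hf p)
    (hΨ.integrable_mul_wilson hh hgc.continuous hg p), ← pairing_wilson, ← pairing_wilson, hfg,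
    sub_self]

/-- Coefficient decay with an explicit rate. -/
theorem exists_norm_pairing_le_exp (hΨ : IsWindowFamily ψ Ψ C a H) {s h : ℝ} (hs : 1 < s)
    (hh : 0 < h) {f : E d → ℂ} (hfc : ContDiff ℝ ∞ f) (hf : gsENorm s h f < ⊤) :
    ∃ A : ℝ, ∀ p, ‖pairing f (wilson ψ p)‖ ≤
      A * Real.exp (-(s / 2 * (1 / (4 * (d + 1)) / h) ^ (1 / s) * idxSize p ^ (1 / s))) := by
  obtain ⟨N, hN, hfN⟩ := exists_gsENorm_le hf
  obtain ⟨A, hA, hb⟩ := hΨ.exists_norm_pairing_le hs hh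
  refine ⟨A * N, fun p => (hb f N hfc hN hfN p).trans ?_⟩
  have hσ := idxSize_nonneg p
  rw [mul_assoc (s / 2), ← Real.mul_rpow (by positivity) hσ]
  -- Replacing `d` by `d + 1` yields a positive rate in every dimension; for `d = 0` the index size
  -- is 0.
  have h1 : 1 / (4 * (d + 1)) / h * idxSize p ≤ idxSize p / (4 * d * h) := by
    rcases Nat.eq_zero_or_pos d with rfl | hd
    · have : idxSize p = 0 := le_antisymm ((idxSize_le_sum p).trans_eq (by simp)) hσ
      simp [this]
    · have hd' : (0 : ℝ) < d := Nat.cast_pos.2 hd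
      calc _ = idxSize p / (4 * (d + 1) * h) := by field_simp
        _ ≤ _ := by gcongr; linarith
  gcongr

end IsWindowFamily

/-! ### Choice of the parameters -/

/-- For the Roumieu case: the growth rate of the Wilson norms tends to 0 as `h` grows. The condition
`h₀ ≤ h` keeps a given function inside the step. -/
theorem exists_rpow_div_lt {s c L : ℝ} (hs : 0 < s) (hc : 0 < c) (hL : 0 < L) (h₀ : ℝ) :
    ∃ h, h₀ ≤ h ∧ 0 < h ∧ (c / h) ^ (1 / s) < L := by
  have h1 : 0 < c / (L / 2) ^ s := by positivity
  refine ⟨max h₀ (c / (L / 2) ^ s), le_max_left _ _, lt_max_of_lt_right h1, ?_⟩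
  calc (c / max h₀ (c / (L / 2) ^ s)) ^ (1 / s) ≤ (c / (c / (L / 2) ^ s)) ^ (1 / s) := by
        gcongr
        exact le_max_right _ _
    _ = L / 2 := by
        rw [div_div_cancel₀ hc.ne', ← Real.rpow_mul (by positivity), mul_one_div_cancel hs.ne',
          Real.rpow_one]
    _ < L := half_lt_self hL

/-- For the Beurling case: small `h` makes the coefficient decay rate as large as desired. -/
theorem exists_lt_rpow_div {s c L : ℝ} (hs : 0 < s) (hc : 0 < c) (hL : 0 ≤ L) :
    ∃ h, 0 < h ∧ L < (c / h) ^ (1 / s) := by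
  refine ⟨c / (L + 1) ^ s, by positivity, ?_⟩
  rw [div_div_cancel₀ hc.ne', ← Real.rpow_mul (by positivity), mul_one_div_cancel hs.ne',
    Real.rpow_one]
  linarith

/-! ### Convergence in the Gelfand-Shilov spaces -/

section Convergence

variable {d : ℕ} {s : ℝ}

theorem step_coe_sum {h : Set.Ioi (0 : ℝ)} {ι : Type*} (S : Finset ι) (u : ι → Step d s h) :
    (∑ p ∈ S, u p).1 = ∑ p ∈ S, (u p).1 :=
  map_sum (stepSubmodule d s h).subtype u S

theorem hasSum_step {h : Set.Ioi (0 : ℝ)} {ι : Type*} {u : ι → Step d s h} {f : Step d s h}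
    (hu : Filter.Tendsto (fun S : Finset ι => gsENorm s h (∑ p ∈ S, (u p).1 - f.1))
      Filter.atTop (𝓝 0)) : HasSum u f := by
  rw [HasSum, SummationFilter.unconditional_filter, tendsto_iff_norm_sub_tendsto_zero]
  have h1 := (ENNReal.tendsto_toReal ENNReal.zero_ne_top).comp hu
  exact h1.congr fun S =>
    congrArg (fun g : E d → ℂ => (gsENorm s h (g - f.1)).toReal) (step_coe_sum S u).symm

/-- Continuity into an infimum of topologies is continuity into each of them. Convergence in one
step therefore suffices for convergence in the inductive limit. -/
theorem continuous_stepToRoumieu (h : Set.Ioi (0 : ℝ)) :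
    Continuous (stepToRoumieu h : Step d s h → Roumieu d s) :=
  continuous_sInf_rng.2 fun _ ht => ht.1 h

theorem hasSum_stepToRoumieu {h : Set.Ioi (0 : ℝ)} {ι : Type*} {u : ι → Step d s h} {f : Step d s h}
    (hu : HasSum u f) : HasSum (fun p => stepToRoumieu h (u p)) (stepToRoumieu h f) :=
  hu.map ({ toFun := stepToRoumieu h, map_zero' := rfl, map_add' := fun _ _ => rfl } :
    Step d s h →+ Roumieu d s) (continuous_stepToRoumieu h)

theorem hasSum_beurling {ι : Type*} {u : ι → Beurling d s} {f : Beurling d s}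
    (hu : ∀ h, HasSum (fun p => beurlingToStep h (u p)) (beurlingToStep h f)) : HasSum u f := by
  rw [HasSum, nhds_iInf, Filter.tendsto_iInf]
  intro h
  rw [nhds_induced, Filter.tendsto_comap_iff]
  refine (hu h).congr fun S => ?_
  exact (map_sum ({ toFun := beurlingToStep h, map_zero' := rfl, map_add' := fun _ _ => rfl } :
    Beurling d s →+ Step d s h) u S).symm

end Convergence

end GelfandShilov

end

/-! ### Proof of the theorem. -/

theorem theorem3p1 (d : ℕ) (s : ℝ) (hs : 1 < s) (ψ : Fin d → ℝ → ℝ)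
    (hψ : ∀ k, GelfandShilov.IsWilsonGenerator (ψ k)) :
    -- the Roumieu case
    (∃ hmem : ∀ p : GelfandShilov.Idx d,
        GelfandShilov.wilson ψ p ∈ GelfandShilov.roumieuSubmodule d s,
      (∀ f : GelfandShilov.Roumieu d s,
        HasSum (fun p => GelfandShilov.pairing f.1 (GelfandShilov.wilson ψ p) •
          GelfandShilov.Roumieu.mk (GelfandShilov.wilson ψ p) (hmem p)) f ∧
        ∃ k : ℝ, 0 < k ∧ GelfandShilov.WeightedSummable s k
          (fun p => GelfandShilov.pairing f.1 (GelfandShilov.wilson ψ p))) ∧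
      (∀ c : GelfandShilov.Idx d → ℂ,
        (∃ k : ℝ, 0 < k ∧ GelfandShilov.WeightedSummable s k c) →
        ∃ f : GelfandShilov.Roumieu d s,
          (∀ p, c p = GelfandShilov.pairing f.1 (GelfandShilov.wilson ψ p)) ∧
          HasSum (fun p => c p •
            GelfandShilov.Roumieu.mk (GelfandShilov.wilson ψ p) (hmem p)) f)) ∧
    -- the Beurling case
    (∃ hmem : ∀ p : GelfandShilov.Idx d,
        GelfandShilov.wilson ψ p ∈ GelfandShilov.beurlingSubmodule d s,
      (∀ f : GelfandShilov.Beurling d s,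
        HasSum (fun p => GelfandShilov.pairing f.1 (GelfandShilov.wilson ψ p) •
          GelfandShilov.Beurling.mk (GelfandShilov.wilson ψ p) (hmem p)) f ∧
        ∀ k : ℝ, 0 ≤ k → GelfandShilov.WeightedSummable s k
          (fun p => GelfandShilov.pairing f.1 (GelfandShilov.wilson ψ p))) ∧
      (∀ c : GelfandShilov.Idx d → ℂ,
        (∀ k : ℝ, 0 ≤ k → GelfandShilov.WeightedSummable s k c) →
        ∃ f : GelfandShilov.Beurling d s,
          (∀ p, c p = GelfandShilov.pairing f.1 (GelfandShilov.wilson ψ p)) ∧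
          HasSum (fun p => c p •
            GelfandShilov.Beurling.mk (GelfandShilov.wilson ψ p) (hmem p)) f)) := by
  obtain ⟨Ψ, C, a, H, hΨ⟩ := GelfandShilov.exists_isWindowFamily hψ
  have hs0 : 0 < s := by linarith
  have hpi := Real.pi_pos
  have hcont := hΨ.contDiff_wilson
  have hfin := fun (h : ℝ) (hh : 0 < h) p => hΨ.gsENorm_wilson_lt_top hs hh p
  have hlarge : ∀ k h₀ : ℝ, 0 < k → ∃ h, h₀ ≤ h ∧ 0 < h ∧
      d * (2 * s * (4 * Real.pi / h) ^ (1 / s)) < k := by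
    intro k h₀ hk
    obtain ⟨h, h1, h2, h3⟩ := GelfandShilov.exists_rpow_div_lt hs0
      (by positivity : 0 < 4 * Real.pi) (by positivity : 0 < k / (2 * s * (d + 1))) h₀
    refine ⟨h, h1, h2, ?_⟩
    rw [lt_div_iff₀ (by positivity)] at h3
    have h4 : 0 ≤ (4 * Real.pi / h) ^ (1 / s) := by positivity
    nlinarith
  constructor
  · refine ⟨fun p => ⟨hcont p, 1, one_pos, hfin 1 one_pos p⟩, fun f => ?_, fun c hc => ?_⟩
    · obtain ⟨hfc, h₀, hh₀, hf₀⟩ := f.2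
      obtain ⟨A, hA⟩ := hΨ.exists_norm_pairing_le_exp hs hh₀ hfc hf₀
      have hk : 0 < s / 2 * (1 / (4 * ((d : ℝ) + 1)) / h₀) ^ (1 / s) := by positivity
      -- The step is enlarged from `h₀` to `h` until the Wilson norms grow more slowly than the
      -- coefficients of `f` decay; both `f` and its series then lie in this step, where
      -- coefficients determine a function.
      obtain ⟨h, hle, hh, hkh⟩ := hlarge _ h₀ hk
      obtain ⟨hgc, hg, hlim, hpair⟩ := hΨ.wilsonSeries_spec hψ hs hh hkh hA
      have hfh := (GelfandShilov.gsENorm_anti s hh₀ hle f.1).trans_lt hf₀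
      have hfg := hΨ.eq_of_pairing_eq hψ hh hfc hgc hfh hg fun p => (hpair p).symm
      rw [← hfg] at hlim
      refine ⟨GelfandShilov.hasSum_stepToRoumieu (h := ⟨h, hh⟩) (f := ⟨f.1, hfc, hfh⟩)
        (u := fun p => GelfandShilov.pairing f.1 (GelfandShilov.wilson ψ p) •
          (⟨GelfandShilov.wilson ψ p, hcont p, hfin h hh p⟩ : GelfandShilov.Step d s ⟨h, hh⟩))
        (GelfandShilov.hasSum_step hlim), _, half_pos hk,
        GelfandShilov.weightedSummable_of_le hs0 (half_lt_self hk) hA⟩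
    · obtain ⟨k, hk, hck⟩ := hc
      obtain ⟨A, hA⟩ := hck.exists_norm_le
      obtain ⟨h, -, hh, hkh⟩ := hlarge k 0 hk
      obtain ⟨hgc, hg, hlim, hpair⟩ := hΨ.wilsonSeries_spec hψ hs hh hkh hA
      exact ⟨⟨_, hgc, h, hh, hg⟩, fun p => (hpair p).symm,
        GelfandShilov.hasSum_stepToRoumieu (h := ⟨h, hh⟩) (f := ⟨_, hgc, hg⟩)
          (u := fun p => c p •
            (⟨GelfandShilov.wilson ψ p, hcont p, hfin h hh p⟩ : GelfandShilov.Step d s ⟨h, hh⟩))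
          (GelfandShilov.hasSum_step hlim)⟩
  · have hseries : ∀ c : GelfandShilov.Idx d → ℂ,
        (∀ k : ℝ, 0 ≤ k → GelfandShilov.WeightedSummable s k c) → ∀ h : ℝ, 0 < h →
        ContDiff ℝ ∞ (GelfandShilov.wilsonSeries ψ c) ∧
          GelfandShilov.gsENorm s h (GelfandShilov.wilsonSeries ψ c) < ⊤ ∧
          Filter.Tendsto (fun S : Finset (GelfandShilov.Idx d) => GelfandShilov.gsENorm s h
            (∑ p ∈ S, c p • GelfandShilov.wilson ψ p - GelfandShilov.wilsonSeries ψ c))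
            Filter.atTop (𝓝 0) ∧
          ∀ q, GelfandShilov.pairing (GelfandShilov.wilsonSeries ψ c)
            (GelfandShilov.wilson ψ q) = c q := by
      intro c hc h hh
      have h0 : 0 ≤ d * (2 * s * (4 * Real.pi / h) ^ (1 / s)) := by positivity
      obtain ⟨A, hA⟩ := (hc (d * (2 * s * (4 * Real.pi / h) ^ (1 / s)) + 1)
        (by linarith)).exists_norm_le
      exact hΨ.wilsonSeries_spec hψ hs hh (lt_add_one _) hA
    refine ⟨fun p => ⟨hcont p, fun h hh => hfin h hh p⟩, fun f => ?_, fun c hc => ?_⟩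
    · obtain ⟨hfc, hf⟩ := f.2
      have hw : ∀ k : ℝ, 0 ≤ k → GelfandShilov.WeightedSummable s k
          (fun p => GelfandShilov.pairing f.1 (GelfandShilov.wilson ψ p)) := by
        intro k hk
        obtain ⟨h, hh, hkh⟩ := GelfandShilov.exists_lt_rpow_div hs0
          (by positivity : 0 < 1 / (4 * ((d : ℝ) + 1))) (by positivity : 0 ≤ k / (s / 2))
        obtain ⟨A, hA⟩ := hΨ.exists_norm_pairing_le_exp hs hh hfc (hf h hh)
        rw [div_lt_iff₀' (by positivity)] at hkh
        exact GelfandShilov.weightedSummable_of_le hs0 hkh hA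
      -- The series does not depend on `h`, so identifying it with `f` in one step is enough;
      -- convergence is then read off in every step.
      obtain ⟨hgc, hg, -, hpair⟩ := hseries _ hw 1 one_pos
      have hfg := hΨ.eq_of_pairing_eq hψ one_pos hfc hgc (hf 1 one_pos) hg fun p => (hpair p).symm
      refine ⟨GelfandShilov.hasSum_beurling fun h => ?_, hw⟩
      obtain ⟨-, -, hlim, -⟩ := hseries _ hw h.1 h.2
      rw [← hfg] at hlim
      exact GelfandShilov.hasSum_step hlim
    · obtain ⟨hgc, -, -, hpair⟩ := hseries c hc 1 one_pos
      refine ⟨⟨_, hgc, fun h hh => (hseries c hc h hh).2.1⟩, fun p => (hpair p).symm,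
        GelfandShilov.hasSum_beurling fun h => ?_⟩
      exact GelfandShilov.hasSum_step (hseries c hc h.1 h.2).2.2.1
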